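/- For $n\ge 1$ let $B_n$ be the Artin braid group with generators $\sigma_1,\dots,\sigma_{n-1}$ and relations $\sigma_i\sigma_{i+1}\sigma_i=\sigma_{i+1}\sigma_i\sigma_{i+1}$ and $\sigma_i\sigma_j=\sigma_j\sigma_i$ for $|i-j|>1$. Let $P_n$ be the kernel of $B_n\to\mathfrak S_n$, and let a hat denote profinite completion. For $1\le i<j\le n$ put $x_{i,j}=(\sigma_{j-1}\cdots\sigma_{i+1})\sigma_i^2(\sigma_{j-1}\cdots\sigma_{i+1})^{-1}\in P_n$. For blocks $A,B$ of consecutive strings, with $A$ to the left of $B$, let $x_{A,B}$ be the product of the $x_{a,b}$, $a\in A$, $b\in B$, in lexicographic order of $(a,b)$ (so $x_{A,B}=1$ if $A$ or $B$ is empty). Let $\widehat F_2$ be the free profinite group on $x,y$. For $f\in\widehat F_2$ let $f(\alpha,\beta)$ denote its image under the continuous homomorphism with $x\mapsto\alpha$, $y\mapsto\beta$, and let $f_{A,B,C}=f(x_{A,B},x_{B,C})$, an element of $\widehat P_n$ or its image in $\widehat B_n$. The group $\widehat{GT}$ consists of the continuous automorphisms $\sigma$ of $\widehat F_2$ such that $\sigma(x)=x^\lambda$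 and $\sigma(y)=f^{-1}y^\lambda f$ for some $(\lambda,f)\in\widehat{\mathbb Z}^\times\times\widehat F_2$ with $$f(x,y)f(y,x)=1,\qquad f(z,x)z^mf(y,z)y^mf(x,y)x^m=1\quad\text{in }\widehat F_2,$$ where $z=(xy)^{-1}$ and $m=\frac{\lambda-1}2\in\widehat{\mathbb Z}$, and $$f_{1,2,34}\,f_{12,3,4}=f_{2,3,4}\,f_{1,23,4}\,f_{1,2,3}\quad\text{in }\widehat P_4;$$ one writes $\sigma=(\lambda,f)$. Let $\sigma=(\lambda,f)\in\widehat{GT}$. For every $n$, $\sigma$ acts on $\widehat B_n$ by Drinfeld's action: there is a continuous automorphism of $\widehat B_n$, again denoted $b\mapsto\sigma(b)$, which is the unique continuous endomorphism of $\widehat B_n$ with $$\sigma(\sigma_1)=\sigma_1^\lambda,\qquad \sigma(\sigma_i)=f_{1\cdots i-1,i,i+1}^{-1}\,\sigma_i^\lambda\, f_{1\cdots i-1,i,i+1}\quad(2\le i\le n-1).$$ For $n>0$ and $m_1,m_2\ge 0$ let $b\mapsto e_{m_1}\otimes b\otimes e_{m_2}$ be the continuous homomorphism $\widehat B_n\to\widehat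 B_{m_1+n+m_2}$ with $\sigma_i\mapsto\sigma_{m_1+i}$. Then for all $n>0$, $m_1,m_2\ge 0$ and $b\in\widehat B_n$, $$\sigma(e_{m_1}\otimes b\otimes e_{m_2})=f_{[m_1],[n],[m_2]}^{-1}\cdot(e_{m_1}\otimes\sigma(b)\otimes e_{m_2})\cdot f_{[m_1],[n],[m_2]},$$ where $$f_{[m_1],[n],[m_2]}=f_{1\cdots m_1,\;m_1+1\cdots m_1+n-1,\;m_1+n}\cdot f_{1\cdots m_1,\;m_1+1\cdots m_1+n-2,\;m_1+n-1}\cdots f_{1\cdots m_1,\;m_1+1,\;m_1+2}\in\widehat B_{m_1+n+m_2}.$$ -/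

import Mathlib

/-! ### Profinite completions and profinite integers -/

/-- The profinite completion `lim G / N`, over the normal subgroups `N` of finite index. -/
abbrev ProfCompl (G : Type) [Group G] : ProfiniteGrp.{0} :=
  ProfiniteGrp.ProfiniteCompletion.completion (GrpCat.of G)

/-- The natural homomorphism from a group to its profinite completion. -/
def toProfCompl (G : Type) [Group G] : G →* ProfCompl G :=
  (ProfiniteGrp.ProfiniteCompletion.eta (GrpCat.of G)).hom

/-- The continuous extension to the profinite completion of a homomorphism to a profinite group. -/
noncomputable def profLift {G : Type} [Group G] {P : ProfiniteGrp.{0}} (φ : G →* P) :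
    ProfCompl G →ₜ* P :=
  (ProfiniteGrp.ProfiniteCompletion.lift (G := GrpCat.of G) (P := P) (GrpCat.ofHom φ)).hom

/-- The continuous homomorphism of profinite completions induced by a group homomorphism. -/
noncomputable def profMap {G H : Type} [Group G] [Group H] (φ : G →* H) :
    ProfCompl G →ₜ* ProfCompl H :=
  profLift ((toProfCompl H).comp φ)

/-- The ring of profinite integers: compatible families of residues modulo all `n ≥ 1`. -/
def ZHat : Subring (∀ n : ℕ+, ZMod n) where
  carrier := {a | ∀ (m n : ℕ+) (h : (m : ℕ) ∣ n), ZMod.castHom h (ZMod m) (a n) = a m}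
  mul_mem' ha hb m n h := by rw [Pi.mul_apply, map_mul, ha m n h, hb m n h, Pi.mul_apply]
  one_mem' m n h := by rw [Pi.one_apply, map_one, Pi.one_apply]
  add_mem' ha hb m n h := by rw [Pi.add_apply, map_add, ha m n h, hb m n h, Pi.add_apply]
  zero_mem' m n h := by rw [Pi.zero_apply, map_zero, Pi.zero_apply]
  neg_mem' ha m n h := by rw [Pi.neg_apply, map_neg, ha m n h, Pi.neg_apply]

/-- The order of the finite quotient `G / N`. -/
noncomputable def finIndex {G : Type} [Group G] (N : FiniteIndexNormalSubgroup G) : ℕ+ :=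
  ⟨N.toSubgroup.index, Nat.pos_of_ne_zero Subgroup.FiniteIndex.index_ne_zero⟩

theorem zhat_pow_compat {G : Type} [Group G] (a : ZHat) {N M : FiniteIndexNormalSubgroup G}
    (h : N ≤ M) (q : G ⧸ M.toSubgroup) :
    q ^ ((a : ∀ n : ℕ+, ZMod n) (finIndex N)).val =
      q ^ ((a : ∀ n : ℕ+, ZMod n) (finIndex M)).val := by
  have hd : ((finIndex M : ℕ+) : ℕ) ∣ (finIndex N : ℕ+) :=
    Subgroup.index_dvd_of_le (H := N.toSubgroup) (K := M.toSubgroup) h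
  have : NeZero ((finIndex N : ℕ+) : ℕ) := ⟨(finIndex N).pos.ne'⟩
  have : NeZero ((finIndex M : ℕ+) : ℕ) := ⟨(finIndex M).pos.ne'⟩
  have key := a.2 (finIndex M) (finIndex N) hd
  rw [pow_eq_pow_iff_modEq]
  refine Nat.ModEq.of_dvd (orderOf_dvd_natCard q) ?_
  change _ ≡ _ [MOD ((finIndex M : ℕ+) : ℕ)]
  rw [← ZMod.natCast_eq_natCast_iff, ZMod.natCast_zmod_val, ← key,
    ZMod.castHom_apply, ZMod.natCast_val]

/-- The power `g ^ a` of an element of a profinite completion with a profinite exponent: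
its component in the finite quotient `G / N` is `g_N ^ r`, where `r` is the residue of `a`
modulo the order of `G / N`. -/
noncomputable def profPow {G : Type} [Group G] (g : ProfCompl G) (a : ZHat) : ProfCompl G :=
  ⟨fun N => (g.1 N) ^ ((a : ∀ n : ℕ+, ZMod n) (finIndex (G := G) N)).val, by
    intro N M h
    rw [map_pow, g.2 h]
    exact zhat_pow_compat (G := G) a h.le (g.1 M)⟩

/-! ### Artin braid groups -/

/-- The braid relations; the index `i` (counted from `0`) stands for `σ_{i+1}`. -/
def braidRels (n : ℕ) : Set (FreeGroup (Fin (n - 1))) :=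
  {r | (∃ i j : Fin (n - 1), (i : ℕ) + 1 = j ∧
      r = (FreeGroup.of i * FreeGroup.of j * FreeGroup.of i) *
        (FreeGroup.of j * FreeGroup.of i * FreeGroup.of j)⁻¹) ∨
    (∃ i j : Fin (n - 1), ((i : ℕ) + 1 < j ∨ (j : ℕ) + 1 < i) ∧
      r = (FreeGroup.of i * FreeGroup.of j) * (FreeGroup.of j * FreeGroup.of i)⁻¹)}

/-- The Artin braid group `B_n` with `n` strings. -/
abbrev Braid (n : ℕ) : Type := PresentedGroup (braidRels n)

/-- The homomorphism out of `B_n` given by elements `s 1, …, s (n - 1)` of a group that satisfy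
the braid relations. -/
def braidLift {G : Type} [Group G] (n : ℕ) (s : ℕ → G)
    (h1 : ∀ i, 1 ≤ i → i + 1 < n → s i * s (i + 1) * s i = s (i + 1) * s i * s (i + 1))
    (h2 : ∀ i j, 1 ≤ i → i + 1 < j → j < n → s i * s j = s j * s i) : Braid n →* G :=
  PresentedGroup.toGroup (f := fun i : Fin (n - 1) => s (i + 1)) (by
    rintro r (⟨i, j, hij, rfl⟩ | ⟨i, j, hij, rfl⟩)
    · simp only [map_mul, map_inv, FreeGroup.lift_apply_of]
      rw [mul_inv_eq_one, ← hij]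
      exact h1 _ (by omega) (by omega)
    · simp only [map_mul, map_inv, FreeGroup.lift_apply_of]
      rw [mul_inv_eq_one]
      rcases hij with hij | hij
      · exact h2 _ _ (by omega) (by omega) (by omega)
      · exact (h2 _ _ (by omega) (by omega) (by omega)).symm)

/-- The generator `σ_i` of `B_n`, for `1 ≤ i ≤ n - 1` (and `1` for all other `i`). -/
def sigma (n i : ℕ) : Braid n :=
  if h : 1 ≤ i ∧ i < n then PresentedGroup.of ⟨i - 1, by omega⟩ else 1

theorem sigma_braid {n i : ℕ} (h1 : 1 ≤ i) (h2 : i + 1 < n) :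
    sigma n i * sigma n (i + 1) * sigma n i =
      sigma n (i + 1) * sigma n i * sigma n (i + 1) := by
  rw [sigma, sigma, dif_pos ⟨h1, by omega⟩, dif_pos ⟨by omega, h2⟩]
  exact PresentedGroup.mk_eq_mk_of_mul_inv_mem
    (Or.inl ⟨⟨i - 1, by omega⟩, ⟨i + 1 - 1, by omega⟩, by simp only; omega, rfl⟩)

theorem sigma_comm {n i j : ℕ} (h1 : 1 ≤ i) (h2 : i + 1 < j) (h3 : j < n) :
    sigma n i * sigma n j = sigma n j * sigma n i := by
  rw [sigma, sigma, dif_pos ⟨h1, by omega⟩, dif_pos ⟨by omega, h3⟩]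
  exact PresentedGroup.mk_eq_mk_of_mul_inv_mem
    (Or.inr ⟨⟨i - 1, by omega⟩, ⟨j - 1, by omega⟩, Or.inl (by simp only; omega), rfl⟩)

/-- The homomorphism `B_n → B_{m₁ + n + m₂}`, `b ↦ e_{m₁} ⊗ b ⊗ e_{m₂}`, with
`σ_i ↦ σ_{m₁ + i}`. -/
def pad (m₁ n m₂ : ℕ) : Braid n →* Braid (m₁ + n + m₂) :=
  braidLift n (fun i => sigma (m₁ + n + m₂) (m₁ + i))
    (fun i h1 h2 => sigma_braid (by omega) (by omega))
    (fun i j h1 h2 h3 => sigma_comm (by omega) (by omega) (by omega))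

/-- The natural projection `B_n → S_n`, which sends `σ_i` to the transposition of the `i`-th and
the `(i + 1)`-st letter. -/
def toPerm (n : ℕ) : Braid n →* Equiv.Perm (Fin n) :=
  braidLift n
    (fun i => if h : 1 ≤ i ∧ i < n then
      Equiv.swap (⟨i - 1, by omega⟩ : Fin n) ⟨i, h.2⟩ else 1)
    (fun i h1 h2 => by
      rw [dif_pos ⟨h1, by omega⟩, dif_pos ⟨by omega, h2⟩]
      have e : (⟨i + 1 - 1, by omega⟩ : Fin n) = ⟨i, by omega⟩ := Fin.ext (by simp)
      rw [e]
      have hab : (⟨i - 1, by omega⟩ : Fin n) ≠ ⟨i, by omega⟩ := by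
        rw [Ne, Fin.mk.injEq]; omega
      have hac : (⟨i - 1, by omega⟩ : Fin n) ≠ ⟨i + 1, by omega⟩ := by
        rw [Ne, Fin.mk.injEq]; omega
      have hbc : (⟨i, by omega⟩ : Fin n) ≠ ⟨i + 1, by omega⟩ := by
        rw [Ne, Fin.mk.injEq]; omega
      generalize (⟨i - 1, by omega⟩ : Fin n) = a at *
      generalize (⟨i, by omega⟩ : Fin n) = b at *
      generalize (⟨i + 1, by omega⟩ : Fin n) = c at *
      have e1 := Equiv.swap_mul_swap_mul_swap hbc.symm hac.symm
      have e2 := Equiv.swap_mul_swap_mul_swap hab hac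
      rw [Equiv.swap_comm b a, Equiv.swap_comm c b] at e1
      rw [e1, e2, Equiv.swap_comm])
    (fun i j h1 h2 h3 => by
      rw [dif_pos ⟨h1, by omega⟩, dif_pos ⟨by omega, h3⟩]
      refine (Equiv.Perm.disjoint_swap_swap ?_).commute.eq
      simp only [List.nodup_cons, List.mem_cons, Fin.mk.injEq]
      simp
      omega)

/-- The pure braid group `P_n`. -/
abbrev PureBraid (n : ℕ) : Type := (toPerm n).ker

theorem sigma_sq_mem (n i : ℕ) : sigma n i ^ 2 ∈ (toPerm n).ker := by
  rw [MonoidHom.mem_ker, map_pow, sigma]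
  split_ifs with h
  · rw [toPerm, braidLift, PresentedGroup.toGroup.of, dif_pos ⟨by omega, by omega⟩, sq,
      Equiv.swap_mul_self]
  · simp

/-- The conjugating word `σ_{j-1} ⋯ σ_{i+1}`, for `i < j`. -/
def sigmaWord (n i j : ℕ) : Braid n :=
  ((List.range' (i + 1) (j - 1 - i)).reverse.map (sigma n)).prod

/-- `x_{i,j} = (σ_{j-1} ⋯ σ_{i+1}) σ_i² (σ_{j-1} ⋯ σ_{i+1})⁻¹` in `P_n`, for `1 ≤ i < j ≤ n`. -/
def pureX (n i j : ℕ) : PureBraid n :=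
  ⟨sigmaWord n i j * sigma n i ^ 2 * (sigmaWord n i j)⁻¹,
    (toPerm n).normal_ker.conj_mem _ (sigma_sq_mem n i) _⟩

/-- For two lists of strings `A` and `B`, the element `x_{A,B}` of `P_n`: the product of the
`x_{a,b}` in lexicographic order of the pairs `(a, b)`. -/
def blockX (n : ℕ) (A B : List ℕ) : PureBraid n :=
  (A.map fun a => (B.map fun b => pureX n a b).prod).prod

/-! ### The profinite Grothendieck-Teichmüller group -/

/-- The free profinite group of rank two. -/
abbrev F2Hat : ProfiniteGrp.{0} := ProfCompl (FreeGroup (Fin 2))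

/-- The first generator. -/
def xHat : F2Hat := toProfCompl _ (FreeGroup.of 0)

/-- The second generator. -/
def yHat : F2Hat := toProfCompl _ (FreeGroup.of 1)

/-- `f(α, β)`: the image of `f` under the continuous homomorphism with `x ↦ α` and `y ↦ β`. -/
noncomputable def evalF2 {P : ProfiniteGrp.{0}} (f : F2Hat) (α β : P) : P :=
  profLift (FreeGroup.lift ![α, β]) f

/-- The element `f_{A,B,C}` of the profinite pure braid group, the image of `f` under
`x ↦ x_{A,B}` and `y ↦ x_{B,C}`. -/
noncomputable def fPure (n : ℕ) (f : F2Hat) (A B C : List ℕ) : ProfCompl (PureBraid n) :=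
  evalF2 f (toProfCompl _ (blockX n A B)) (toProfCompl _ (blockX n B C))

/-- The image of `f_{A,B,C}` in the profinite braid group. -/
noncomputable def fBraid (n : ℕ) (f : F2Hat) (A B C : List ℕ) : ProfCompl (Braid n) :=
  profMap (toPerm n).ker.subtype (fPure n f A B C)

/-- `σ = (lam, f)` is an element of the profinite Grothendieck-Teichmüller group. -/
structure IsGTElement (σ : F2Hat ≃ₜ* F2Hat) (lam : ZHatˣ) (f : F2Hat) : Prop where
  map_x : σ xHat = profPow xHat lam
  map_y : σ yHat = f⁻¹ * profPow yHat lam * f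
  two_cycle : evalF2 f xHat yHat * evalF2 f yHat xHat = 1
  /-- The relation `f(z,x) z^m f(y,z) y^m f(x,y) x^m = 1`, where `z = (xy)⁻¹` and
  `m = (lam - 1) / 2`. -/
  hexagon : ∃ m : ZHat, (lam : ZHat) = 2 * m + 1 ∧
    evalF2 f (xHat * yHat)⁻¹ xHat * profPow (xHat * yHat)⁻¹ m *
      evalF2 f yHat (xHat * yHat)⁻¹ * profPow yHat m *
      evalF2 f xHat yHat * profPow xHat m = 1
  pentagon : fPure 4 f [1] [2] [3, 4] * fPure 4 f [1, 2] [3] [4] =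
    fPure 4 f [2] [3] [4] * fPure 4 f [1] [2, 3] [4] * fPure 4 f [1] [2] [3]

/-- The prescribed values of `(lam, f)` on the generators of the profinite braid group:
`σ_1 ↦ σ_1 ^ lam` and `σ_i ↦ f_{1⋯i-1,i,i+1}⁻¹ σ_i ^ lam f_{1⋯i-1,i,i+1}` for `2 ≤ i ≤ n - 1`. -/
def ActsOnGenerators (lam : ZHatˣ) (f : F2Hat) (n : ℕ)
    (φ : ProfCompl (Braid n) → ProfCompl (Braid n)) : Prop :=
  (2 ≤ n → φ (toProfCompl _ (sigma n 1)) = profPow (toProfCompl _ (sigma n 1)) lam) ∧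
  ∀ i, 2 ≤ i → i < n → φ (toProfCompl _ (sigma n i)) =
    (fBraid n f (List.range' 1 (i - 1)) [i] [i + 1])⁻¹ *
      profPow (toProfCompl _ (sigma n i)) lam *
      fBraid n f (List.range' 1 (i - 1)) [i] [i + 1]

/-- `f_{[m₁],[n],[m₂]}`: the product over `k = n - 1, …, 1`, in this order, of
`f_{1⋯m₁, m₁+1⋯m₁+k, m₁+k+1}`. -/
noncomputable def fBracket (f : F2Hat) (m₁ n m₂ : ℕ) : ProfCompl (Braid (m₁ + n + m₂)) :=
  ((List.range' 1 (n - 1)).reverse.map fun k =>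
    fBraid (m₁ + n + m₂) f (List.range' 1 m₁) (List.range' (m₁ + 1) k) [m₁ + k + 1]).prod

/-! For fixed `m₁`, `m₂`, both sides of the formula are continuous homomorphisms in `b`, so they
need only be compared on the generators. There the claim is `gtSigma_eq_conj`, whose engine is the
pentagon relation for cables of widths `m`, `i - 1`, `1`, `1`: f_{m,i-1,2} f_{m+i-1,1,1} =
(f_{i-1,1,1} shifted by m) f_{m,i,1} f_{m,i-1,1}. The first factor commutes with σ_{m+i}, so
conjugating σ_{m+i}^λ by f_{m+i-1,1,1} amounts to conjugating it by the right-hand side. Its last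
two factors are neighbours in the bracket product; all other factors of the bracket commute with
what they conjugate.

The cabled pentagon (`fBlock_pentagon`) needs homomorphisms from `P_4` to `B_N` that replace strands
by cables. On `B_4` cabling is only a crossed homomorphism, since the widths are permuted. It is
therefore built as a homomorphism to a wreath product from crossings satisfying the Yang-Baxter
equation, and then restricted to pure braids. `coe_blockX` identifies the lexicographic products
x_{A,B} with double crossings of blocks, so all commutations are read off geometrically.

Drinfeld's action itself is also constructed. The pentagon reduces the braid relation to three
strands, where it follows from the hexagon (`braid_of_hexagon`). The image of the resulting
endomorphism is closed and contains every generator (`sigma_mem_of_gtSigma_mem`), and a surjective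
continuous endomorphism is injective because the braid group is finitely generated
(`profCompl_hopfian`). -/

open Filter Topology

/-! ### Profinite completions and profinite powers -/

section Completion

variable {G : Type} [Group G]

theorem denseRange_toProfCompl : DenseRange (toProfCompl G) :=
  ProfiniteGrp.ProfiniteCompletion.denseRange (GrpCat.of G)

theorem profLift_toProfCompl {P : ProfiniteGrp.{0}} (φ : G →* P) (g : G) :
    profLift φ (toProfCompl G g) = φ g :=
  CategoryTheory.ConcreteCategory.congr_hom
    (ProfiniteGrp.ProfiniteCompletion.lift_eta (G := GrpCat.of G) (P := P) (GrpCat.ofHom φ)) g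

theorem profMap_toProfCompl {H : Type} [Group H] (φ : G →* H) (g : G) :
    profMap φ (toProfCompl G g) = toProfCompl H (φ g) :=
  profLift_toProfCompl _ _

/-- Continuous homomorphisms out of a profinite completion are determined on the group. -/
theorem profCompl_hom_ext {Q : Type*} [Group Q] [TopologicalSpace Q] [T2Space Q]
    {φ ψ : ProfCompl G →ₜ* Q} (h : ∀ g, φ (toProfCompl G g) = ψ (toProfCompl G g))
    (x : ProfCompl G) : φ x = ψ x :=
  congrFun (denseRange_toProfCompl.equalizer φ.continuous_toFun ψ.continuous_toFun
    (funext h)) x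

/-- The projection of the profinite completion to the finite quotient `G / N`. -/
def profProj (N : FiniteIndexNormalSubgroup G) : ProfCompl G →* G ⧸ N.toSubgroup where
  toFun x := x.1 N
  map_one' := rfl
  map_mul' _ _ := rfl

theorem profCompl_ext {x y : ProfCompl G} (h : ∀ N, profProj N x = profProj N y) : x = y :=
  Subtype.ext (funext h)

/-- The residue of a profinite integer modulo the order of `G / N`, as a natural number. -/
noncomputable def zhatRes (a : ZHat) (N : FiniteIndexNormalSubgroup G) : ℕ :=
  ((a : ∀ n : ℕ+, ZMod n) (finIndex N)).val

theorem profProj_profPow (N : FiniteIndexNormalSubgroup G) (x : ProfCompl G) (a : ZHat) :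
    profProj N (profPow x a) = profProj N x ^ zhatRes a N := rfl

theorem pow_eq_pow_of_cast_eq (N : FiniteIndexNormalSubgroup G) (q : G ⧸ N.toSubgroup) {k l : ℕ}
    (h : (k : ZMod (finIndex N)) = l) : q ^ k = q ^ l := by
  rw [pow_eq_pow_iff_modEq]
  exact ((ZMod.natCast_eq_natCast_iff _ _ _).1 h).of_dvd (orderOf_dvd_natCard q)

theorem zhatRes_cast (a : ZHat) (N : FiniteIndexNormalSubgroup G) :
    (zhatRes a N : ZMod (finIndex N)) = (a : ∀ n : ℕ+, ZMod n) (finIndex N) :=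
  have : NeZero ((finIndex N : ℕ+) : ℕ) := ⟨(finIndex N).pos.ne'⟩
  ZMod.natCast_zmod_val _

theorem profPow_add (x : ProfCompl G) (a b : ZHat) :
    profPow x (a + b) = profPow x a * profPow x b :=
  profCompl_ext fun N => by
    rw [map_mul, profProj_profPow, profProj_profPow, profProj_profPow, ← pow_add]
    apply pow_eq_pow_of_cast_eq
    rw [Nat.cast_add, zhatRes_cast, zhatRes_cast, zhatRes_cast]; rfl

theorem profPow_mul (x : ProfCompl G) (a b : ZHat) :
    profPow x (a * b) = profPow (profPow x a) b :=
  profCompl_ext fun N => by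
    rw [profProj_profPow, profProj_profPow, profProj_profPow, ← pow_mul]
    apply pow_eq_pow_of_cast_eq
    rw [Nat.cast_mul, zhatRes_cast, zhatRes_cast, zhatRes_cast]; rfl

theorem profPow_natCast (x : ProfCompl G) (k : ℕ) : profPow x (k : ZHat) = x ^ k :=
  profCompl_ext fun N => by
    rw [profProj_profPow, map_pow]
    apply pow_eq_pow_of_cast_eq
    rw [zhatRes_cast]; rfl

theorem profPow_one (x : ProfCompl G) : profPow x 1 = x := by
  simpa using profPow_natCast x 1

theorem profPow_two (x : ProfCompl G) : profPow x 2 = x ^ 2 := by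
  simpa using profPow_natCast x 2

theorem profPow_conj (y x : ProfCompl G) (a : ZHat) :
    profPow (y * x * y⁻¹) a = y * profPow x a * y⁻¹ :=
  profCompl_ext fun N => by
    simp only [profProj_profPow, map_mul, map_inv, conj_pow]

theorem Commute.profPow_mul {x y : ProfCompl G} (h : Commute x y) (a : ZHat) :
    profPow (x * y) a = profPow x a * profPow y a :=
  profCompl_ext fun N => by
    simp only [profProj_profPow, map_mul]
    exact (h.map (profProj N)).mul_pow _

theorem profPow_inv (x : ProfCompl G) (a : ZHat) : profPow x⁻¹ a = (profPow x a)⁻¹ :=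
  profCompl_ext fun N => by
    simp only [profProj_profPow, map_inv, inv_pow]

theorem Commute.profPow_right {x y : ProfCompl G} (h : Commute x y) (a : ZHat) :
    Commute x (profPow y a) :=
  profCompl_ext fun N => by
    simp only [profProj_profPow, map_mul]
    exact (h.map (profProj N)).pow_right _

/-- The positive number `k!`. -/
def pnatFactorial (k : ℕ) : ℕ+ := ⟨k.factorial, k.factorial_pos⟩

/-- Profinite powers are limits of ordinary powers. -/
theorem tendsto_pow_profPow (x : ProfCompl G) (a : ZHat) :
    Tendsto (fun k => x ^ ((a : ∀ n : ℕ+, ZMod n) (pnatFactorial k)).val) atTop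
      (𝓝 (profPow x a)) := by
  refine Topology.IsInducing.subtypeVal.tendsto_nhds_iff.2 (tendsto_pi_nhds.2 fun N => ?_)
  apply tendsto_nhds_of_eventually_eq
  -- Once `k` reaches the index of `N`, the index divides `k!`, so the residue modulo `k!`
  -- determines the residue modulo the index.
  filter_upwards [eventually_ge_atTop ((finIndex N : ℕ+) : ℕ)] with k hk
  change profProj N (x ^ _) = profProj N (profPow x a)
  rw [profProj_profPow, map_pow]
  apply pow_eq_pow_of_cast_eq
  have : NeZero ((pnatFactorial k : ℕ+) : ℕ) := ⟨(pnatFactorial k).pos.ne'⟩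
  have hd : ((finIndex N : ℕ+) : ℕ) ∣ pnatFactorial k := Nat.dvd_factorial (finIndex N).pos hk
  rw [zhatRes_cast, ← a.2 _ _ hd, ZMod.castHom_apply, ZMod.natCast_val]

/-- A continuous homomorphism need not respect the chosen finite quotients, so the argument passes
through limits of ordinary powers. -/
theorem map_profPow {H : Type} [Group H] (φ : ProfCompl G →ₜ* ProfCompl H) (x : ProfCompl G)
    (a : ZHat) : φ (profPow x a) = profPow (φ x) a := by
  refine tendsto_nhds_unique ((φ.continuous_toFun.tendsto _).comp (tendsto_pow_profPow x a)) ?_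
  convert tendsto_pow_profPow (φ x) a using 2
  exact map_pow φ _ _

end Completion

/-! ### Evaluation of elements of the free profinite group -/

section Evaluation

variable {P Q : ProfiniteGrp.{0}}

theorem evalF2_xHat (α β : P) : evalF2 xHat α β = α := by
  simp [evalF2, xHat, profLift_toProfCompl]

theorem evalF2_yHat (α β : P) : evalF2 yHat α β = β := by
  simp [evalF2, yHat, profLift_toProfCompl]

theorem f2Hat_hom_ext {Q : Type*} [Group Q] [TopologicalSpace Q] [T2Space Q]
    {φ ψ : F2Hat →ₜ* Q} (hx : φ xHat = ψ xHat) (hy : φ yHat = ψ yHat) (f : F2Hat) :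
    φ f = ψ f := by
  refine profCompl_hom_ext (fun g => ?_) f
  refine DFunLike.congr_fun (f := (φ : F2Hat →* Q).comp (toProfCompl _))
    (g := (ψ : F2Hat →* Q).comp (toProfCompl _)) (FreeGroup.ext_hom _ _ fun i => ?_) g
  fin_cases i
  exacts [hx, hy]

/-- Every continuous homomorphism out of the free profinite group is an evaluation. -/
theorem hom_eq_evalF2 (φ : F2Hat →ₜ* P) (f : F2Hat) : φ f = evalF2 f (φ xHat) (φ yHat) :=
  f2Hat_hom_ext (ψ := profLift (FreeGroup.lift ![φ xHat, φ yHat]))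
    (evalF2_xHat _ _).symm (evalF2_yHat _ _).symm f

theorem map_evalF2 (φ : P →ₜ* Q) (f : F2Hat) (α β : P) :
    φ (evalF2 f α β) = evalF2 f (φ α) (φ β) := by
  have := hom_eq_evalF2 (φ.comp (profLift (FreeGroup.lift ![α, β]))) f
  refine this.trans ?_
  change evalF2 f (φ (evalF2 xHat α β)) (φ (evalF2 yHat α β)) = _
  rw [evalF2_xHat, evalF2_yHat]

theorem evalF2_mem {H : Subgroup P} (hH : IsClosed (H : Set P)) {α β : P} (hα : α ∈ H)
    (hβ : β ∈ H) (f : F2Hat) : evalF2 f α β ∈ H := by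
  have hd : Dense (Set.range (toProfCompl (FreeGroup (Fin 2)))) := denseRange_toProfCompl
  have hc : IsClosed ((fun f : F2Hat => evalF2 f α β) ⁻¹' (H : Set P)) :=
    hH.preimage (profLift (FreeGroup.lift ![α, β])).continuous_toFun
  refine hc.closure_subset_iff.2 ?_ (hd f)
  rintro _ ⟨w, rfl⟩
  change profLift _ _ ∈ H
  rw [profLift_toProfCompl]
  have : Set.range ![α, β] ⊆ H := by
    rintro _ ⟨i, rfl⟩
    fin_cases i
    exacts [hα, hβ]
  have h2 := (Subgroup.closure_le H).2 this
  rw [← FreeGroup.range_lift_eq_closure] at h2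
  exact h2 ⟨w, rfl⟩

theorem Commute.evalF2_right {g α β : P} (hα : Commute g α) (hβ : Commute g β) (f : F2Hat) :
    Commute g (evalF2 f α β) := by
  have hc : IsClosed ((Subgroup.centralizer {g} : Subgroup P) : Set P) :=
    Set.isClosed_centralizer _
  have := evalF2_mem hc (α := α) (β := β)
    (Subgroup.mem_centralizer_singleton_iff.2 hα.eq.symm)
    (Subgroup.mem_centralizer_singleton_iff.2 hβ.eq.symm) f
  exact (Subgroup.mem_centralizer_singleton_iff.1 this).symm

/-- Conjugation by an element, as a continuous homomorphism. -/
def conjHom (g : P) : P →ₜ* P where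
  toMonoidHom := (MulAut.conj g).toMonoidHom
  continuous_toFun := (continuous_const.mul continuous_id).mul continuous_const

theorem evalF2_conj (f : F2Hat) (g α β : P) :
    evalF2 f (g * α * g⁻¹) (g * β * g⁻¹) = g * evalF2 f α β * g⁻¹ :=
  (map_evalF2 (conjHom g) f α β).symm

/-- A factor of the first variable that commutes with both variables can be split off. -/
theorem evalF2_mul_left_of_commute (f : F2Hat) {α β ζ : P} (hα : Commute ζ α)
    (hβ : Commute ζ β) : evalF2 f (α * ζ) β = evalF2 f α β * evalF2 f ζ 1 := by
  -- The product of two homomorphisms with commuting images is a homomorphism; its values at the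
  -- generators are `α * ζ` and `β`.
  let ψ : F2Hat →ₜ* P :=
    { toFun := fun f => evalF2 f α β * evalF2 f ζ 1
      map_one' := by simp [evalF2]
      map_mul' := fun f g => by
        have h := ((hα.evalF2_right hβ g).symm.evalF2_right (Commute.one_right _) f).symm.eq
        simp only [evalF2, map_mul] at h ⊢
        rw [mul_assoc, mul_assoc, ← mul_assoc _ (profLift _ f), ← h]
        group
      continuous_toFun :=
        (profLift (FreeGroup.lift ![α, β])).continuous_toFun.mul
          (profLift (FreeGroup.lift ![ζ, 1])).continuous_toFun }
  have := hom_eq_evalF2 ψ f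
  change evalF2 f α β * evalF2 f ζ 1 = evalF2 f (evalF2 xHat α β * evalF2 xHat ζ 1)
    (evalF2 yHat α β * evalF2 yHat ζ 1) at this
  rw [this]
  simp only [evalF2_xHat, evalF2_yHat, mul_one]

end Evaluation

/-! ### Crossings of blocks of strands -/

section BlockCrossing

variable {N : ℕ}

theorem commute_sigma {i j : ℕ} (h : i + 1 < j) : Commute (sigma N i) (sigma N j) := by
  by_cases h1 : 1 ≤ i
  · by_cases h2 : j < N
    · exact sigma_comm h1 h h2
    · rw [sigma.eq_def N j, dif_neg (by omega)]
      exact Commute.one_right _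
  · rw [sigma.eq_def N i, dif_neg (by omega)]
    exact Commute.one_left _

/-- The braid `σ_{p+a} ⋯ σ_{p+1}`: the strand at position `p + a + 1` crosses the `a` strands
to its left. -/
def strandCross (N p : ℕ) : ℕ → Braid N
  | 0 => 1
  | a + 1 => sigma N (p + a + 1) * strandCross N p a

/-- The crossing of the block of `a` strands after position `p` with the next `b` strands. -/
def blockCross (N p a : ℕ) : ℕ → Braid N
  | 0 => 1
  | b + 1 => blockCross N p a b * strandCross N (p + b) a

/-- The double crossing of the block of `a` strands after position `p` with the next `b`
strands. -/
def doubleCross (N p a b : ℕ) : Braid N := blockCross N p a b * blockCross N p b a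

theorem strandCross_add (p a a' : ℕ) :
    strandCross N p (a + a') = strandCross N (p + a) a' * strandCross N p a := by
  induction a' with
  | zero => simp [strandCross]
  | succ a' ih => rw [← add_assoc, strandCross, ih, strandCross, mul_assoc, ← add_assoc p]

theorem strandCross_mem {H : Subgroup (Braid N)} {p a : ℕ}
    (h : ∀ j, p < j → j ≤ p + a → sigma N j ∈ H) : strandCross N p a ∈ H := by
  induction a with
  | zero => exact H.one_mem
  | succ a ih =>
    exact H.mul_mem (h _ (by omega) (by omega)) (ih fun j h1 h2 => h j h1 (by omega))

theorem blockCross_mem {H : Subgroup (Braid N)} {p a b : ℕ}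
    (h : ∀ j, p < j → j < p + a + b → sigma N j ∈ H) : blockCross N p a b ∈ H := by
  induction b with
  | zero => exact H.one_mem
  | succ b ih =>
    exact H.mul_mem (ih fun j h1 h2 => h j h1 (by omega))
      (strandCross_mem fun j h1 h2 => h j (by omega) (by omega))

theorem doubleCross_mem {H : Subgroup (Braid N)} {p a b : ℕ}
    (h : ∀ j, p < j → j < p + a + b → sigma N j ∈ H) : doubleCross N p a b ∈ H :=
  H.mul_mem (blockCross_mem h) (blockCross_mem fun j h1 h2 => h j h1 (by omega))

theorem commute_iff_mem_centralizer {G : Type*} [Group G] {g h : G} :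
    Commute g h ↔ h ∈ Subgroup.centralizer {g} :=
  ⟨fun e => Subgroup.mem_centralizer_singleton_iff.2 e.eq.symm,
    fun e => (Subgroup.mem_centralizer_singleton_iff.1 e).symm⟩

theorem commute_strandCross {g : Braid N} {p a : ℕ}
    (h : ∀ j, p < j → j ≤ p + a → Commute g (sigma N j)) : Commute g (strandCross N p a) :=
  commute_iff_mem_centralizer.2
    (strandCross_mem fun j h1 h2 => commute_iff_mem_centralizer.1 (h j h1 h2))

theorem commute_blockCross {g : Braid N} {p a b : ℕ}
    (h : ∀ j, p < j → j < p + a + b → Commute g (sigma N j)) : Commute g (blockCross N p a b) :=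
  commute_iff_mem_centralizer.2
    (blockCross_mem fun j h1 h2 => commute_iff_mem_centralizer.1 (h j h1 h2))

theorem commute_doubleCross {g : Braid N} {p a b : ℕ}
    (h : ∀ j, p < j → j < p + a + b → Commute g (sigma N j)) :
    Commute g (doubleCross N p a b) :=
  commute_iff_mem_centralizer.2
    (doubleCross_mem fun j h1 h2 => commute_iff_mem_centralizer.1 (h j h1 h2))

theorem blockCross_zero_left (p b : ℕ) : blockCross N p 0 b = 1 := by
  induction b with
  | zero => rfl
  | succ b ih => rw [blockCross, ih, strandCross, one_mul]

theorem doubleCross_zero_left (p b : ℕ) : doubleCross N p 0 b = 1 := by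
  rw [doubleCross, blockCross_zero_left, blockCross, one_mul]

theorem doubleCross_zero_right (p a : ℕ) : doubleCross N p a 0 = 1 := by
  rw [doubleCross, blockCross_zero_left, blockCross, one_mul]

theorem blockCross_one_right (p a : ℕ) : blockCross N p a 1 = strandCross N p a := by
  simp [blockCross]

theorem blockCross_one_one (p : ℕ) : blockCross N p 1 1 = sigma N (p + 1) := by
  simp [blockCross, strandCross]

theorem doubleCross_one_one (p : ℕ) : doubleCross N p 1 1 = sigma N (p + 1) ^ 2 := by
  rw [doubleCross, blockCross_one_one, sq]

theorem blockCross_add_right (p a b b' : ℕ) :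
    blockCross N p a (b + b') = blockCross N p a b * blockCross N (p + b) a b' := by
  induction b' with
  | zero => simp [blockCross]
  | succ b' ih => rw [← add_assoc, blockCross, ih, blockCross, mul_assoc, add_assoc p]

theorem blockCross_add_left (p a a' b : ℕ) :
    blockCross N p (a + a') b = blockCross N (p + a) a' b * blockCross N p a b := by
  induction b with
  | zero => simp [blockCross]
  | succ b ih =>
    have h : Commute (blockCross N p a b) (strandCross N (p + a + b) a') :=
      commute_strandCross fun j h1 h2 => (commute_blockCross fun i h3 h4 =>
        (commute_sigma (by omega)).symm).symm
    rw [blockCross, ih, strandCross_add, blockCross, blockCross,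
      mul_assoc, ← mul_assoc (blockCross N p a b), add_right_comm p b a, h.eq]
    simp only [mul_assoc]

/-- A crossing between two of the `a` strands slides through the single strand that crosses them
all, which shifts it by one position. -/
theorem sigma_strandCross_succ {p a i : ℕ} (h1 : 1 ≤ i) (h2 : i < a) (h3 : p + a < N) :
    sigma N (p + i) * strandCross N p a = strandCross N p a * sigma N (p + 1 + i) := by
  induction a with
  | zero => omega
  | succ a ih =>
    rcases Nat.lt_or_ge i a with h | h
    · rw [strandCross, ← mul_assoc,
        (commute_sigma (N := N) (i := p + i) (j := p + a + 1) (by omega)).eq, mul_assoc,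
        ih h (by omega), mul_assoc]
    · obtain rfl : i = a := by omega
      obtain ⟨k, rfl⟩ : ∃ k, i = k + 1 := ⟨i - 1, by omega⟩
      have hc : Commute (strandCross N p k) (sigma N (p + (k + 1) + 1)) :=
        (commute_strandCross fun j h4 h5 => (commute_sigma (by omega)).symm).symm
      have hb := sigma_braid (n := N) (i := p + k + 1) (by omega) (by omega)
      rw [strandCross, strandCross, mul_assoc, mul_assoc,
        show p + 1 + (k + 1) = p + (k + 1) + 1 by omega, hc.eq]
      simp only [← mul_assoc, ← add_assoc]
      rw [hb]

/-- Two adjacent strands cross the same `a` strands in parallel, so their mutual crossing may take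
place before or after. -/
theorem sigma_strandCross_pair {p a : ℕ} (h : p + a + 1 < N) :
    sigma N (p + a + 1) * (strandCross N p a * strandCross N (p + 1) a) =
      strandCross N p a * strandCross N (p + 1) a * sigma N (p + 1) := by
  induction a with
  | zero => simp [strandCross]
  | succ a ih =>
    have hc : Commute (strandCross N p a) (sigma N (p + 1 + a + 1)) :=
      (commute_strandCross fun j h4 h5 => (commute_sigma (by omega)).symm).symm
    have hb := sigma_braid (n := N) (i := p + a + 1) (by omega) (by omega)
    rw [strandCross, strandCross,
      show sigma N (p + a + 1) * strandCross N p a *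
          (sigma N (p + 1 + a + 1) * strandCross N (p + 1) a) =
        sigma N (p + a + 1) * (strandCross N p a * sigma N (p + 1 + a + 1)) *
          strandCross N (p + 1) a by simp only [mul_assoc], hc.eq,
      show p + (a + 1) + 1 = p + a + 1 + 1 by omega, show p + 1 + a + 1 = p + a + 1 + 1 by omega]
    calc _ = (sigma N (p + a + 1 + 1) * sigma N (p + a + 1) * sigma N (p + a + 1 + 1)) *
          (strandCross N p a * strandCross N (p + 1) a) := by simp only [mul_assoc]
      _ = sigma N (p + a + 1) * sigma N (p + a + 1 + 1) * (sigma N (p + a + 1) *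
          (strandCross N p a * strandCross N (p + 1) a)) := by rw [← hb]; simp only [mul_assoc]
      _ = _ := by rw [ih (by omega)]; simp only [mul_assoc]

theorem sigma_blockCross_left {p a b i : ℕ} (h1 : 1 ≤ i) (h2 : i < a) (h3 : p + a + b ≤ N) :
    sigma N (p + i) * blockCross N p a b = blockCross N p a b * sigma N (p + b + i) := by
  induction b with
  | zero => simp [blockCross]
  | succ b ih =>
    rw [blockCross, ← mul_assoc, ih (by omega), mul_assoc,
      sigma_strandCross_succ h1 h2 (by omega), mul_assoc, add_assoc p b 1]

theorem sigma_blockCross_right {p a b j : ℕ} (h1 : 1 ≤ j) (h2 : j < b) (h3 : p + a + b ≤ N) :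
    sigma N (p + a + j) * blockCross N p a b = blockCross N p a b * sigma N (p + j) := by
  induction b with
  | zero => omega
  | succ b ih =>
    rcases Nat.lt_or_ge j b with h | h
    · have hc : Commute (sigma N (p + j)) (strandCross N (p + b) a) :=
        commute_strandCross fun k h4 h5 => commute_sigma (by omega)
      rw [blockCross, ← mul_assoc, ih h (by omega), mul_assoc, hc.eq, mul_assoc]
    · obtain ⟨k, rfl⟩ : ∃ k, j = k + 1 := ⟨j - 1, by omega⟩
      obtain rfl : b = k + 1 := by omega
      have hc : Commute (sigma N (p + a + (k + 1))) (blockCross N p a k) :=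
        commute_blockCross fun l h4 h5 => (commute_sigma (by omega)).symm
      have hp := sigma_strandCross_pair (N := N) (p := p + k) (a := a) (by omega)
      rw [blockCross, blockCross, mul_assoc (blockCross N p a k), ← mul_assoc, hc.eq, mul_assoc,
        show p + a + (k + 1) = p + k + a + 1 by omega, ← add_assoc p k 1, hp]
      simp only [mul_assoc]

/-- A crossing inside one block slides through the first block crossing and returns to its place
through the second. The excluded indices are the boundaries of the two blocks. -/
theorem commute_sigma_doubleCross {p a b j : ℕ} (h : p + a + b ≤ N) (h1 : j ≠ p)
    (h2 : j ≠ p + a) (h3 : j ≠ p + a + b) : Commute (sigma N j) (doubleCross N p a b) := by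
  rcases Nat.lt_or_ge j p with hj | hj
  · exact commute_doubleCross fun k h4 h5 => commute_sigma (by omega)
  rcases Nat.lt_or_ge (p + a + b) j with hj' | hj'
  · exact commute_doubleCross fun k h4 h5 => (commute_sigma (by omega)).symm
  unfold Commute SemiconjBy doubleCross
  rcases Nat.lt_or_ge j (p + a) with hj'' | hj''
  · obtain ⟨i, rfl⟩ := Nat.exists_eq_add_of_le hj
    rw [← mul_assoc, sigma_blockCross_left (by omega) (by omega) h, mul_assoc,
      sigma_blockCross_right (by omega) (by omega) (by omega), mul_assoc]
  · obtain ⟨i, rfl⟩ := Nat.exists_eq_add_of_le hj''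
    rw [← mul_assoc, sigma_blockCross_right (by omega) (by omega) h, mul_assoc,
      sigma_blockCross_left (by omega) (by omega) (by omega), mul_assoc]

theorem strandCross_blockCross {p a b q c : ℕ} (h : p + a + b ≤ N) (hc : q + c < b) :
    strandCross N (p + a + q) c * blockCross N p a b =
      blockCross N p a b * strandCross N (p + q) c := by
  induction c with
  | zero => simp [strandCross]
  | succ c ih =>
    rw [strandCross, mul_assoc, ih (by omega), ← mul_assoc, add_assoc (p + a), add_assoc (p + a),
      sigma_blockCross_right (by omega) (by omega) (by omega), strandCross, mul_assoc,
      ← add_assoc p, ← add_assoc p]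

theorem blockCross_blockCross {p a b q c d : ℕ} (h : p + a + b ≤ N) (hc : q + c + d ≤ b) :
    blockCross N (p + a + q) c d * blockCross N p a b =
      blockCross N p a b * blockCross N (p + q) c d := by
  induction d with
  | zero => simp [blockCross]
  | succ d ih =>
    rw [blockCross, mul_assoc, add_assoc (p + a), strandCross_blockCross h (by omega),
      ← mul_assoc, ih (by omega), blockCross, mul_assoc, add_assoc p]

/-- The crossing of the blocks `b` and `c` slides through the crossing of `a` with their union. This
supplies the braid relation for cables. -/
theorem blockCross_yangBaxter {p a b c : ℕ} (h : p + a + b + c ≤ N) :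
    blockCross N p a b * blockCross N (p + b) a c * blockCross N p b c =
      blockCross N (p + a) b c * blockCross N p a c * blockCross N (p + c) a b := by
  have := blockCross_blockCross (N := N) (p := p) (a := a) (b := b + c) (q := 0) (c := b) (d := c)
    (by omega) (by omega)
  rw [← blockCross_add_right, mul_assoc, ← blockCross_add_right, add_comm c b]
  exact this.symm

theorem sigmaWord_eq (i a : ℕ) :
    ((List.range' (i + 1) a).reverse.map (sigma N)).prod = strandCross N i a := by
  induction a with
  | zero => simp [strandCross]
  | succ a ih =>
    rw [List.range'_concat, List.reverse_append, List.map_append, List.prod_append, ih,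
      strandCross]
    simp [add_right_comm]

theorem coe_pureX (p a : ℕ) : (pureX N p (p + a + 1) : Braid N) =
    strandCross N p a * sigma N p ^ 2 * (strandCross N p a)⁻¹ := by
  rw [← sigmaWord_eq]
  simp [pureX, sigmaWord]

theorem doubleCross_one_succ (p b : ℕ) : doubleCross N p 1 (b + 1) =
    doubleCross N p 1 b *
      ((strandCross N p b)⁻¹ * sigma N (p + b + 1) ^ 2 * strandCross N p b) := by
  have h : blockCross N p 1 (b + 1) = blockCross N p 1 b * sigma N (p + b + 1) := by
    rw [blockCross, ← blockCross_one_right, blockCross_one_one]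
  rw [doubleCross, doubleCross, blockCross_one_right, blockCross_one_right, h, strandCross]
  simp only [sq, mul_assoc, mul_inv_cancel_left]

/-- The conjugation carries the `b` strands past the `a` strands that separate them from strand `p +
1`, lets the two link there, and carries them back. -/
theorem coe_prod_pureX {p a b : ℕ} (h : p + 1 + a + b ≤ N) :
    ((((List.range' (p + a + 2) b).map fun j => pureX N (p + 1) j).prod : PureBraid N) : Braid N) =
      blockCross N (p + 1) a b * doubleCross N p 1 b * (blockCross N (p + 1) a b)⁻¹ := by
  induction b with
  | zero => simp [doubleCross, blockCross, strandCross]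
  | succ b ih =>
    rw [List.range'_concat, List.map_append, List.prod_append, Subgroup.coe_mul, ih (by omega),
      List.map_singleton, List.prod_singleton,
      show p + a + 2 + 1 * b = p + 1 + (a + b) + 1 by omega, coe_pureX, doubleCross_one_succ,
      blockCross]
    have hw : Commute (strandCross N (p + 1 + b) a) (doubleCross N p 1 b) :=
      (commute_strandCross fun j h1 h2 => (commute_doubleCross fun k h3 h4 =>
        (commute_sigma (by omega)).symm).symm).symm
    have hE : Commute (blockCross N (p + 2) a b) (sigma N (p + 1)) :=
      (commute_blockCross fun j h1 h2 => commute_sigma (by omega)).symm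
    have hv := sigma_strandCross_pair (N := N) (p := p) (a := b) (by omega)
    have hu : blockCross N (p + 1) a b * strandCross N (p + 1 + b) a * strandCross N (p + 1) b =
        strandCross N (p + 1) (a + b) * blockCross N (p + 2) a b := by
      have := strandCross_blockCross (N := N) (p := p + 1) (a := a) (b := b + 1)
        (q := 0) (c := b) (by omega) (by omega)
      rw [add_zero, add_zero] at this
      rw [← blockCross, ← this, add_comm b 1, blockCross_add_right, blockCross_one_right,
        strandCross_add, mul_assoc]
    generalize blockCross N (p + 1) a b = C at *
    generalize strandCross N (p + 1 + b) a = w at *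
    generalize doubleCross N p 1 b = D at *
    generalize strandCross N (p + 1) (a + b) = u at *
    generalize blockCross N (p + 2) a b = E at *
    generalize strandCross N (p + 1) b = v' at *
    generalize strandCross N p b = v at *
    generalize sigma N (p + b + 1) = s at *
    generalize sigma N (p + 1) = t at *
    -- Two words for the same pure generator: the linking of the two outer strands can be performed
    -- at either end of the `b` strands between them.
    have hs : v⁻¹ * s ^ 2 * v = v' * t ^ 2 * v'⁻¹ := by
      have : s = (v * v') * t * (v * v')⁻¹ := by rw [← hv]; group
      rw [this, conj_pow]; group
    have hC : C * w = u * E * v'⁻¹ := by rw [← hu]; group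
    rw [hs]
    calc C * D * C⁻¹ * (u * t ^ 2 * u⁻¹)
        = C * D * C⁻¹ * (u * (t ^ 2 * E) * E⁻¹ * u⁻¹) := by group
      _ = C * D * C⁻¹ * (u * (E * t ^ 2) * E⁻¹ * u⁻¹) := by rw [(hE.pow_right 2).eq]
      _ = C * D * C⁻¹ * ((u * E * v'⁻¹) * v' * t ^ 2 * v'⁻¹ * (u * E * v'⁻¹)⁻¹) := by group
      _ = C * (D * w) * (v' * t ^ 2 * v'⁻¹) * (C * w)⁻¹ := by rw [← hC]; group
      _ = _ := by rw [← hw.eq]; group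

/-- The element `x_{A,B}` of adjacent blocks is their double crossing. -/
theorem coe_blockX {p a b : ℕ} (h : p + a + b ≤ N) :
    (blockX N (List.range' (p + 1) a) (List.range' (p + a + 1) b) : Braid N) =
      doubleCross N p a b := by
  induction a generalizing p with
  | zero => simp [blockX, doubleCross_zero_left]
  | succ a ih =>
    have h1 : blockX N (List.range' (p + 1) (a + 1)) (List.range' (p + (a + 1) + 1) b) =
        ((List.range' (p + a + 2) b).map fun j => pureX N (p + 1) j).prod *
          blockX N (List.range' (p + 1 + 1) a) (List.range' (p + 1 + a + 1) b) := by
      rw [blockX, blockX, List.range'_succ, List.map_cons, List.prod_cons,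
        show p + (a + 1) + 1 = p + a + 2 by omega, show p + 1 + a + 1 = p + a + 2 by omega]
    rw [h1, Subgroup.coe_mul, ih (by omega), coe_prod_pureX (by omega), doubleCross, doubleCross,
      doubleCross, add_comm a 1, blockCross_add_left, blockCross_add_right]
    group

end BlockCrossing

/-! ### Crossed homomorphisms from labelled crossings -/

section CrossedHom

variable {G : Type} [Group G]

/-- Permutations act on the functions of a vector of labels. -/
def labelAct (n : ℕ) (G : Type) [Group G] :
    Equiv.Perm (Fin n) →* MulAut ((Fin n → ℕ) → G) where
  toFun π :=
    { toFun := fun φ k => φ (k ∘ π)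
      invFun := fun φ k => φ (k ∘ π.symm)
      left_inv := fun φ => funext fun k => congrArg φ (by ext; simp)
      right_inv := fun φ => funext fun k => congrArg φ (by ext; simp)
      map_mul' := fun _ _ => rfl }
  map_one' := rfl
  map_mul' _ _ := rfl

/-- The permutation of the letters by `σ_i`. -/
abbrev sigmaPerm (n i : ℕ) : Equiv.Perm (Fin n) := toPerm n (sigma n i)

/-- A family of crossings of labelled strands that satisfies the braid relations. -/
structure CrossingFamily (n : ℕ) (G : Type) [Group G] where
  /-- The value of the crossing `σ_i` of strands labelled by `k`. -/
  val : ℕ → (Fin n → ℕ) → G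
  braid : ∀ i k, 1 ≤ i → i + 1 < n →
    val i k * val (i + 1) (k ∘ sigmaPerm n i) *
        val i (k ∘ sigmaPerm n i ∘ sigmaPerm n (i + 1)) =
      val (i + 1) k * val i (k ∘ sigmaPerm n (i + 1)) *
        val (i + 1) (k ∘ sigmaPerm n (i + 1) ∘ sigmaPerm n i)
  comm : ∀ i j k, 1 ≤ i → i + 1 < j → j < n →
    val i k * val j (k ∘ sigmaPerm n i) = val j k * val i (k ∘ sigmaPerm n j)

namespace CrossingFamily

variable {n : ℕ} (c : CrossingFamily n G)

/-- The homomorphism from the braid group to a wreath product defined by a family of crossings. -/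
def wreathHom : Braid n →* ((Fin n → ℕ) → G) ⋊[labelAct n G] Equiv.Perm (Fin n) :=
  braidLift n (fun i => ⟨c.val i, sigmaPerm n i⟩)
    (fun i h1 h2 => SemidirectProduct.ext (funext fun k => c.braid i k h1 h2) (by
      simp only [SemidirectProduct.mul_right, ← map_mul, sigma_braid h1 h2]))
    (fun i j h1 h2 h3 => SemidirectProduct.ext (funext fun k => c.comm i j k h1 h2 h3) (by
      simp only [SemidirectProduct.mul_right, ← map_mul, sigma_comm h1 h2 h3]))

theorem wreathHom_sigma {i : ℕ} (h1 : 1 ≤ i) (h2 : i < n) :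
    c.wreathHom (sigma n i) = ⟨c.val i, sigmaPerm n i⟩ := by
  rw [sigma, dif_pos ⟨h1, h2⟩, wreathHom, braidLift, PresentedGroup.toGroup.of]
  simp only [Nat.sub_add_cancel h1]

theorem wreathHom_right (b : Braid n) : (c.wreathHom b).right = toPerm n b := by
  refine DFunLike.congr_fun (f := SemidirectProduct.rightHom.comp c.wreathHom) (g := toPerm n)
    (PresentedGroup.ext fun i => ?_) b
  have hi : PresentedGroup.of i = sigma n (i + 1) := by
    rw [sigma, dif_pos ⟨by omega, by omega⟩]; rfl
  rw [hi, MonoidHom.comp_apply, c.wreathHom_sigma (by omega) (by omega)]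
  rfl

/-- The value of a braid on strands labelled by `k`. -/
def braidVal (k : Fin n → ℕ) (b : Braid n) : G := (c.wreathHom b).left k

/-- The cocycle rule: `b'` meets the labels as permuted by `b`. The twist disappears on pure braids,
which makes `pureHom` a homomorphism. -/
theorem braidVal_mul (k : Fin n → ℕ) (b b' : Braid n) :
    c.braidVal k (b * b') = c.braidVal k b * c.braidVal (k ∘ toPerm n b) b' := by
  rw [braidVal, map_mul, SemidirectProduct.mul_left, wreathHom_right]; rfl

theorem braidVal_sigma (k : Fin n → ℕ) {i : ℕ} (h1 : 1 ≤ i) (h2 : i < n) :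
    c.braidVal k (sigma n i) = c.val i k := by
  rw [braidVal, c.wreathHom_sigma h1 h2]

/-- The homomorphism from the pure braid group with labels `k`. -/
def pureHom (k : Fin n → ℕ) : PureBraid n →* G where
  toFun b := c.braidVal k b
  map_one' := by simp [braidVal]
  map_mul' b b' := by
    have : toPerm n b = 1 := b.2
    rw [Subgroup.coe_mul, braidVal_mul, this]; rfl

end CrossingFamily

end CrossedHom

/-! ### Images of the pentagon relation, and cabling -/

section FourStrands

theorem toPerm_sigma {n i : ℕ} (h : 1 ≤ i ∧ i < n) : toPerm n (sigma n i) =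
    Equiv.swap (⟨i - 1, by omega⟩ : Fin n) ⟨i, h.2⟩ := by
  rw [sigma, dif_pos h, toPerm, braidLift, PresentedGroup.toGroup.of]
  simp only [Nat.sub_add_cancel h.1, dif_pos h]

theorem comp_sigmaPerm_one (a b c d : ℕ) :
    ![a, b, c, d] ∘ sigmaPerm 4 1 = ![b, a, c, d] := by
  rw [sigmaPerm, toPerm_sigma (by omega)]
  ext i; fin_cases i <;> rfl

theorem comp_sigmaPerm_two (a b c d : ℕ) :
    ![a, b, c, d] ∘ sigmaPerm 4 2 = ![a, c, b, d] := by
  rw [sigmaPerm, toPerm_sigma (by omega)]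
  ext i; fin_cases i <;> rfl

theorem comp_sigmaPerm_three (a b c d : ℕ) :
    ![a, b, c, d] ∘ sigmaPerm 4 3 = ![a, b, d, c] := by
  rw [sigmaPerm, toPerm_sigma (by omega)]
  ext i; fin_cases i <;> rfl

/-- A family of crossings of four strands, given by the three crossings. -/
def CrossingFamily.four {G : Type} [Group G] (c₁ c₂ c₃ : ℕ → ℕ → ℕ → ℕ → G)
    (h12 : ∀ a b c d, c₁ a b c d * c₂ b a c d * c₁ b c a d =
      c₂ a b c d * c₁ a c b d * c₂ c a b d)
    (h23 : ∀ a b c d, c₂ a b c d * c₃ a c b d * c₂ a c d b =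
      c₃ a b c d * c₂ a b d c * c₃ a d b c)
    (h13 : ∀ a b c d, c₁ a b c d * c₃ b a c d = c₃ a b c d * c₁ a b d c) :
    CrossingFamily 4 G where
  val i k := if i = 1 then c₁ (k 0) (k 1) (k 2) (k 3) else
    if i = 2 then c₂ (k 0) (k 1) (k 2) (k 3) else c₃ (k 0) (k 1) (k 2) (k 3)
  braid i k h1 h2 := by
    obtain ⟨a, b, c, d, rfl⟩ : ∃ a b c d, k = ![a, b, c, d] :=
      ⟨k 0, k 1, k 2, k 3, by ext i; fin_cases i <;> rfl⟩
    obtain rfl | rfl : i = 1 ∨ i = 2 := by omega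
    · simp only [← Function.comp_assoc, Nat.reduceAdd, comp_sigmaPerm_one, comp_sigmaPerm_two]
      exact h12 a b c d
    · simp only [← Function.comp_assoc, Nat.reduceAdd, comp_sigmaPerm_three, comp_sigmaPerm_two]
      exact h23 a b c d
  comm i j k h1 h2 h3 := by
    obtain ⟨a, b, c, d, rfl⟩ : ∃ a b c d, k = ![a, b, c, d] :=
      ⟨k 0, k 1, k 2, k 3, by ext i; fin_cases i <;> rfl⟩
    obtain ⟨rfl, rfl⟩ : i = 1 ∧ j = 3 := by omega
    simp only [comp_sigmaPerm_one, comp_sigmaPerm_three]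
    exact h13 a b c d

variable {G : Type} [Group G]

theorem pureHom_blockX (c : CrossingFamily 4 G) (k : Fin 4 → ℕ) {p a b : ℕ}
    (h : p + a + b ≤ 4) :
    c.pureHom k (blockX 4 (List.range' (p + 1) a) (List.range' (p + a + 1) b)) =
      c.braidVal k (doubleCross 4 p a b) :=
  congrArg (c.braidVal k) (coe_blockX h)

theorem pureHom_pentagon {P : ProfiniteGrp.{0}} {f : F2Hat}
    (hf : fPure 4 f [1] [2] [3, 4] * fPure 4 f [1, 2] [3] [4] =
      fPure 4 f [2] [3] [4] * fPure 4 f [1] [2, 3] [4] * fPure 4 f [1] [2] [3])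
    (θ : PureBraid 4 →* P) :
    evalF2 f (θ (blockX 4 [1] [2])) (θ (blockX 4 [2] [3, 4])) *
        evalF2 f (θ (blockX 4 [1, 2] [3])) (θ (blockX 4 [3] [4])) =
      evalF2 f (θ (blockX 4 [2] [3])) (θ (blockX 4 [3] [4])) *
        evalF2 f (θ (blockX 4 [1] [2, 3])) (θ (blockX 4 [2, 3] [4])) *
        evalF2 f (θ (blockX 4 [1] [2])) (θ (blockX 4 [2] [3])) := by
  have := congrArg (profLift θ) hf
  simpa only [map_mul, fPure, map_evalF2, profLift_toProfCompl] using this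

section Values

variable (c₁ c₂ c₃ : ℕ → ℕ → ℕ → ℕ → G)
  (h12 : ∀ a b c d, c₁ a b c d * c₂ b a c d * c₁ b c a d =
    c₂ a b c d * c₁ a c b d * c₂ c a b d)
  (h23 : ∀ a b c d, c₂ a b c d * c₃ a c b d * c₂ a c d b =
    c₃ a b c d * c₂ a b d c * c₃ a d b c)
  (h13 : ∀ a b c d, c₁ a b c d * c₃ b a c d = c₃ a b c d * c₁ a b d c)
  (a b c d : ℕ)

theorem braidVal_four_one_mul (g : Braid 4) :
    (CrossingFamily.four c₁ c₂ c₃ h12 h23 h13).braidVal ![a, b, c, d] (sigma 4 1 * g) =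
      c₁ a b c d * (CrossingFamily.four c₁ c₂ c₃ h12 h23 h13).braidVal ![b, a, c, d] g := by
  rw [CrossingFamily.braidVal_mul, CrossingFamily.braidVal_sigma _ _ (by omega) (by omega),
    comp_sigmaPerm_one]
  rfl

theorem braidVal_four_two_mul (g : Braid 4) :
    (CrossingFamily.four c₁ c₂ c₃ h12 h23 h13).braidVal ![a, b, c, d] (sigma 4 2 * g) =
      c₂ a b c d * (CrossingFamily.four c₁ c₂ c₃ h12 h23 h13).braidVal ![a, c, b, d] g := by
  rw [CrossingFamily.braidVal_mul, CrossingFamily.braidVal_sigma _ _ (by omega) (by omega),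
    comp_sigmaPerm_two]
  rfl

theorem braidVal_four_three_mul (g : Braid 4) :
    (CrossingFamily.four c₁ c₂ c₃ h12 h23 h13).braidVal ![a, b, c, d] (sigma 4 3 * g) =
      c₃ a b c d * (CrossingFamily.four c₁ c₂ c₃ h12 h23 h13).braidVal ![a, b, d, c] g := by
  rw [CrossingFamily.braidVal_mul, CrossingFamily.braidVal_sigma _ _ (by omega) (by omega),
    comp_sigmaPerm_three]
  rfl

theorem braidVal_four_one :
    (CrossingFamily.four c₁ c₂ c₃ h12 h23 h13).braidVal ![a, b, c, d] (sigma 4 1) =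
      c₁ a b c d := by
  rw [CrossingFamily.braidVal_sigma _ _ (by omega) (by omega)]
  rfl

theorem braidVal_four_two :
    (CrossingFamily.four c₁ c₂ c₃ h12 h23 h13).braidVal ![a, b, c, d] (sigma 4 2) =
      c₂ a b c d := by
  rw [CrossingFamily.braidVal_sigma _ _ (by omega) (by omega)]
  rfl

theorem braidVal_four_three :
    (CrossingFamily.four c₁ c₂ c₃ h12 h23 h13).braidVal ![a, b, c, d] (sigma 4 3) =
      c₃ a b c d := by
  rw [CrossingFamily.braidVal_sigma _ _ (by omega) (by omega)]
  rfl

/-- The image of the pentagon relation, in terms of the crossings. -/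
theorem pentagon_four
    (h12 : ∀ a b c d, c₁ a b c d * c₂ b a c d * c₁ b c a d =
      c₂ a b c d * c₁ a c b d * c₂ c a b d)
    (h23 : ∀ a b c d, c₂ a b c d * c₃ a c b d * c₂ a c d b =
      c₃ a b c d * c₂ a b d c * c₃ a d b c)
    (h13 : ∀ a b c d, c₁ a b c d * c₃ b a c d = c₃ a b c d * c₁ a b d c)
    (a b c d : ℕ) {P : ProfiniteGrp.{0}} {f : F2Hat}
    (hf : fPure 4 f [1] [2] [3, 4] * fPure 4 f [1, 2] [3] [4] =
      fPure 4 f [2] [3] [4] * fPure 4 f [1] [2, 3] [4] * fPure 4 f [1] [2] [3]) (θ : G →* P) :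
    evalF2 f (θ (c₁ a b c d * c₁ b a c d))
        (θ (c₂ a b c d * (c₃ a c b d * (c₃ a c d b * c₂ a c b d)))) *
      evalF2 f (θ (c₂ a b c d * (c₁ a c b d * (c₁ c a b d * c₂ a c b d))))
        (θ (c₃ a b c d * c₃ a b d c)) =
    evalF2 f (θ (c₂ a b c d * c₂ a c b d)) (θ (c₃ a b c d * c₃ a b d c)) *
      evalF2 f (θ (c₁ a b c d * (c₂ b a c d * (c₂ b c a d * c₁ b a c d))))
        (θ (c₃ a b c d * (c₂ a b d c * (c₂ a d b c * c₃ a b d c)))) *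
      evalF2 f (θ (c₁ a b c d * c₁ b a c d)) (θ (c₂ a b c d * c₂ a c b d)) := by
  have := pureHom_pentagon hf
    (θ.comp ((CrossingFamily.four c₁ c₂ c₃ h12 h23 h13).pureHom ![a, b, c, d]))
  simp only [MonoidHom.comp_apply] at this
  rw [show blockX 4 [1] [2] = blockX 4 (List.range' (0 + 1) 1) (List.range' (0 + 1 + 1) 1) from rfl,
    show blockX 4 [2] [3] = blockX 4 (List.range' (1 + 1) 1) (List.range' (1 + 1 + 1) 1) from rfl,
    show blockX 4 [3] [4] = blockX 4 (List.range' (2 + 1) 1) (List.range' (2 + 1 + 1) 1) from rfl,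
    show blockX 4 [1] [2, 3] = blockX 4 (List.range' (0 + 1) 1) (List.range' (0 + 1 + 1) 2) from rfl,
    show blockX 4 [2] [3, 4] = blockX 4 (List.range' (1 + 1) 1) (List.range' (1 + 1 + 1) 2) from rfl,
    show blockX 4 [1, 2] [3] = blockX 4 (List.range' (0 + 1) 2) (List.range' (0 + 2 + 1) 1) from rfl,
    show blockX 4 [2, 3] [4] = blockX 4 (List.range' (1 + 1) 2) (List.range' (1 + 2 + 1) 1) from rfl,
    pureHom_blockX _ _ (by omega), pureHom_blockX _ _ (by omega), pureHom_blockX _ _ (by omega),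
    pureHom_blockX _ _ (by omega), pureHom_blockX _ _ (by omega), pureHom_blockX _ _ (by omega),
    pureHom_blockX _ _ (by omega)] at this
  simp only [doubleCross, blockCross, strandCross, Nat.reduceAdd, one_mul, mul_one,
    mul_assoc] at this
  simpa only [mul_assoc, braidVal_four_one_mul, braidVal_four_two_mul,
    braidVal_four_three_mul, braidVal_four_one, braidVal_four_two, braidVal_four_three] using this

end Values

/-- The relation `f(α, 1) = 1`, a consequence of the pentagon relation. -/
theorem evalF2_one_right {P : ProfiniteGrp.{0}} {f : F2Hat}
    (hf : fPure 4 f [1] [2] [3, 4] * fPure 4 f [1, 2] [3] [4] =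
      fPure 4 f [2] [3] [4] * fPure 4 f [1] [2, 3] [4] * fPure 4 f [1] [2] [3])
    (α : P) : evalF2 f α 1 = 1 := by
  have h1 : evalF2 f (1 : P) 1 = 1 := by
    have hc : IsClosed ((⊥ : Subgroup P) : Set P) := by simp
    exact Subgroup.mem_bot.1 (evalF2_mem hc (one_mem _) (one_mem _) f)
  -- Only the strands labelled `1` and `2` interact, so every pure generator except x_{1,2} becomes
  -- trivial. The pentagon then reads f(α,1) = f(α,1) f(α,1), up to factors f(1,1) = 1.
  have := pentagon_four
    (fun a b _ _ => if a = 1 ∧ b = 2 then α else 1)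
    (fun _ a b _ => if a = 1 ∧ b = 2 then α else 1)
    (fun _ _ a b => if a = 1 ∧ b = 2 then α else 1)
    (fun a b c _ => by split_ifs <;> simp)
    (fun _ a b c => by split_ifs <;> simp)
    (fun a b c d => by split_ifs <;> simp) 1 2 0 0 hf (MonoidHom.id P)
  simpa [h1] using this

/-- The element `f_{A,B,C}` of adjacent blocks of sizes `a`, `b`, `c` after position `p`. -/
noncomputable def fBlock (N : ℕ) (f : F2Hat) (p a b c : ℕ) : ProfCompl (Braid N) :=
  evalF2 f (toProfCompl _ (doubleCross N p a b)) (toProfCompl _ (doubleCross N (p + a) b c))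

/-- The pentagon relation for cables. -/
theorem fBlock_pentagon {N : ℕ} {f : F2Hat}
    (hf : fPure 4 f [1] [2] [3, 4] * fPure 4 f [1, 2] [3] [4] =
      fPure 4 f [2] [3] [4] * fPure 4 f [1] [2, 3] [4] * fPure 4 f [1] [2] [3])
    {a b c d : ℕ} (h : a + b + c + d ≤ N) :
    fBlock N f 0 a b (c + d) * fBlock N f 0 (a + b) c d =
      fBlock N f a b c d * fBlock N f 0 a (b + c) d * fBlock N f 0 a b c := by
  -- The labels are the cable widths. The family must satisfy its relations for all labels, hence
  -- the value `1` when the cables do not fit into `N` strands; the test depends only on the total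
  -- width, which permutations preserve.
  have := pentagon_four
    (fun a b c d => if a + b + c + d ≤ N then blockCross N 0 a b else 1)
    (fun a b c d => if a + b + c + d ≤ N then blockCross N a b c else 1)
    (fun a b c d => if a + b + c + d ≤ N then blockCross N (a + b) c d else 1)
    (fun a b c d => by
      by_cases h : a + b + c + d ≤ N
      · rw [if_pos h, if_pos (by omega), if_pos (by omega), if_pos h, if_pos (by omega),
          if_pos (by omega)]
        have := blockCross_yangBaxter (N := N) (p := 0) (a := a) (b := b) (c := c) (by omega)
        simpa only [zero_add] using this
      · rw [if_neg h, if_neg (by omega), if_neg (by omega), if_neg h, if_neg (by omega),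
          if_neg (by omega)])
    (fun a b c d => by
      by_cases h : a + b + c + d ≤ N
      · rw [if_pos h, if_pos (by omega), if_pos (by omega), if_pos h, if_pos (by omega),
          if_pos (by omega)]
        exact blockCross_yangBaxter (by omega)
      · rw [if_neg h, if_neg (by omega), if_neg (by omega), if_neg h, if_neg (by omega),
          if_neg (by omega)])
    (fun a b c d => by
      by_cases h : a + b + c + d ≤ N
      · rw [if_pos h, if_pos (by omega), if_pos h, if_pos (by omega), add_comm b a]
        exact commute_blockCross fun j h1 h2 => (commute_blockCross fun i h3 h4 =>
          (commute_sigma (by omega)).symm).symm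
      · rw [if_neg h, if_neg (by omega), if_neg h, if_neg (by omega)]) a b c d hf
    (toProfCompl (Braid N))
  simp only [h, show b + a + c + d ≤ N by omega, show a + c + b + d ≤ N by omega,
    show a + c + d + b ≤ N by omega, show c + a + b + d ≤ N by omega,
    show b + c + a + d ≤ N by omega, show a + b + d + c ≤ N by omega,
    show a + d + b + c ≤ N by omega, if_true] at this
  simp only [fBlock, doubleCross, blockCross_add_left, blockCross_add_right, zero_add]
  simpa only [mul_assoc] using this

end FourStrands

/-! ### From the hexagon relation to the braid relation -/

section Hexagon

theorem garside_mul_left {G : Type*} [Group G] {a b : G} (hab : a * b * a = b * a * b) :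
    a * b * a * a = b * (a * b * a) := by
  calc _ = b * a * b * a := by rw [hab]
    _ = _ := by simp only [mul_assoc]

theorem garside_mul_right {G : Type*} [Group G] {a b : G} (hab : a * b * a = b * a * b) :
    a * b * a * b = a * (a * b * a) := by
  calc _ = a * (b * a * b) := by simp only [mul_assoc]
    _ = _ := by rw [hab]

/-- The algebraic form of the passage from the hexagon relation to the braid relation. -/
theorem braid_of_hexagon_word {G : Type*} [Group G] {a b s X Y W : G}
    (hab : a * b * a = b * a * b) (hs : a * b * a * s = s⁻¹ * (a * b * a))
    (hX : a * b * a * X = Y * (a * b * a)) (hY : a * b * a * Y = X * (a * b * a))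
    (hYb : Commute Y b)
    (hWa : Commute W a) (hWb : Commute W b) (hWs : Commute W s) (hWX : Commute W X)
    (hWY : Commute W Y)
    (h : a * s⁻¹ * a⁻¹ * (a * Y * a⁻¹ * W⁻¹) * (b⁻¹ * s⁻¹ * b) * Y * s * X = 1) :
    X * a * (s⁻¹ * (Y * b) * s) * (X * a) =
      s⁻¹ * (Y * b) * s * (X * a) * (s⁻¹ * (Y * b) * s) := by
  set A := X * a with hA
  set B := s⁻¹ * (Y * b) * s with hB
  set t := a * b * a * s with ht
  have hΔb := garside_mul_left hab
  have hΔa := garside_mul_right hab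
  have hWB : Commute W B := (hWs.inv_right.mul_right (hWY.mul_right hWb)).mul_right hWs
  have hWt : Commute W t := ((hWa.mul_right hWb).mul_right hWa).mul_right hWs
  -- The hexagon word, conjugated by `a` and with the central-type factor `W` moved aside.
  have h1 : B * t⁻¹ * (B * A) = W := by
    have e1 : B * t⁻¹ = s⁻¹ * Y * a⁻¹ * b⁻¹ := by
      rw [hB, ht, hab]; group
    have e2 : B = s⁻¹ * (b * Y) * s := by rw [hB, hYb.eq]
    have e3 : W⁻¹ * (b⁻¹ * s⁻¹ * b * Y * s * X) = b⁻¹ * s⁻¹ * b * Y * s * X * W⁻¹ := by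
      have : Commute W (b⁻¹ * s⁻¹ * b * Y * s * X) :=
        ((((hWb.inv_right.mul_right hWs.inv_right).mul_right hWb).mul_right hWY).mul_right
          hWs).mul_right hWX
      exact this.inv_left.eq
    have e4 : a * s⁻¹ * Y * a⁻¹ * (b⁻¹ * s⁻¹ * b * Y * s * X) * W⁻¹ = 1 := by
      rw [← h, mul_assoc _ _ W⁻¹, ← e3]; group
    have e5 := mul_inv_eq_one.1 e4
    rw [e1, e2, hA]
    calc _ = a⁻¹ * (a * s⁻¹ * Y * a⁻¹ * (b⁻¹ * s⁻¹ * b * Y * s * X)) * a := by group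
      _ = W := by rw [e5, mul_assoc, hWa.eq, inv_mul_cancel_left]
  have hBAB : B * A * B = t * W := by
    have e : B * A = t * B⁻¹ * W := by rw [← h1]; group
    rw [e, mul_assoc, hWB.eq]; group
  -- `t` plays the part of the Garside element for `A` and `B`: conjugation by it exchanges them.
  -- Together with `hBAB` this turns `A * B * A` into `B * A * B`.
  have htA : t * A = B * t := by
    have e : s * t = a * b * a := by rw [hs, mul_inv_cancel_left]
    calc t * A = s⁻¹ * (a * b * a * X) * a := by rw [hs, hA]; group
      _ = s⁻¹ * Y * (a * b * a * a) := by rw [hX]; group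
      _ = B * t := by rw [hΔb, hB, mul_assoc _ s t, e]; group
  have htB : t * B = A * t := by
    calc t * B = (a * b * a * Y) * b * s := by rw [ht, hB]; group
      _ = X * (a * b * a * b) * s := by rw [hY]; group
      _ = A * t := by rw [hΔa, hA, ht]; group
  clear_value A B t
  have e : A * B * A * t = t * W * t := by
    calc A * B * A * t = A * B * (t * B) := by rw [htB]; group
      _ = A * (t * A) * B := by rw [htA]; group
      _ = (A * t) * A * B := by group
      _ = t * (B * A * B) := by rw [← htB]; group
      _ = t * W * t := by rw [hBAB, mul_assoc t W t, hWt.eq]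
  rw [hBAB]
  exact mul_right_cancel e

variable {f : F2Hat}

theorem evalF2_swap (h2 : evalF2 f xHat yHat * evalF2 f yHat xHat = 1) {P : ProfiniteGrp.{0}}
    (α β : P) : evalF2 f β α = (evalF2 f α β)⁻¹ := by
  have := congrArg (profLift (FreeGroup.lift ![α, β])) h2
  rw [map_mul, map_evalF2, map_evalF2, map_one] at this
  change evalF2 f (evalF2 xHat α β) (evalF2 yHat α β) *
    evalF2 f (evalF2 yHat α β) (evalF2 xHat α β) = 1 at this
  rw [evalF2_xHat, evalF2_yHat] at this
  exact (inv_eq_of_mul_eq_one_right this).symm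

theorem profPow_two_mul_add_one {G : Type} [Group G] (a : ProfCompl G) (m : ZHat) :
    profPow a (2 * m + 1) = profPow (a ^ 2) m * a := by
  rw [profPow_add, profPow_mul, profPow_two, profPow_one]

/-- The hexagon is evaluated at x = a², y = b². With Δ = aba, conjugation by Δ exchanges `a` and
`b`, and Δ² commutes with both. So z is a conjugate of y times Δ⁻², and f(z,x), f(y,z) become
conjugates of f(y,x) = s⁻¹. -/
theorem braid_of_hexagon {G : Type} [Group G] {m : ZHat}
    (h2 : evalF2 f xHat yHat * evalF2 f yHat xHat = 1)
    (h3 : evalF2 f (xHat * yHat)⁻¹ xHat * profPow (xHat * yHat)⁻¹ m *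
      evalF2 f yHat (xHat * yHat)⁻¹ * profPow yHat m *
      evalF2 f xHat yHat * profPow xHat m = 1)
    (h1 : ∀ α : ProfCompl G, evalF2 f α 1 = 1) {a b : ProfCompl G}
    (hab : a * b * a = b * a * b) {s : ProfCompl G} (hs : s = evalF2 f (a ^ 2) (b ^ 2)) :
    profPow a (2 * m + 1) * (s⁻¹ * profPow b (2 * m + 1) * s) * profPow a (2 * m + 1) =
      s⁻¹ * profPow b (2 * m + 1) * s * profPow a (2 * m + 1) *
        (s⁻¹ * profPow b (2 * m + 1) * s) := by
  have hΔa := mul_inv_eq_iff_eq_mul.2 (garside_mul_left hab)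
  have hΔb := mul_inv_eq_iff_eq_mul.2 (garside_mul_right hab)
  set Δ := a * b * a with hΔ
  have hωa : Commute (Δ * Δ) a := by
    rw [Commute, SemiconjBy, mul_assoc, mul_inv_eq_iff_eq_mul.1 hΔa, ← mul_assoc,
      mul_inv_eq_iff_eq_mul.1 hΔb, mul_assoc]
  have hωb : Commute (Δ * Δ) b := by
    rw [Commute, SemiconjBy, mul_assoc, mul_inv_eq_iff_eq_mul.1 hΔb, ← mul_assoc,
      mul_inv_eq_iff_eq_mul.1 hΔa, mul_assoc]
  have hx' : b⁻¹ * a ^ 2 * b⁻¹⁻¹ = a * b ^ 2 * a⁻¹ := by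
    have : b⁻¹ * a * b = a * b * a⁻¹ := by
      rw [eq_mul_inv_iff_mul_eq, mul_assoc, mul_assoc, inv_mul_eq_iff_eq_mul, ← mul_assoc,
        ← mul_assoc, ← hab]
    calc _ = (b⁻¹ * a * b) ^ 2 := by simp only [sq]; group
      _ = _ := by rw [this, conj_pow]
  -- By `hx'` the same conjugate of b² is also a conjugate of a² by b⁻¹; the first form serves
  -- f(z,x), the second f(y,z).
  have hz : (a ^ 2 * b ^ 2)⁻¹ = a * b ^ 2 * a⁻¹ * (Δ * Δ)⁻¹ := by
    rw [inv_eq_iff_mul_eq_one, ← mul_assoc, mul_inv_eq_one, ← hx']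
    calc a ^ 2 * b ^ 2 * (b⁻¹ * a ^ 2 * b⁻¹⁻¹) = a * (a * b * a) * (a * b) := by simp only [sq]; group
      _ = a * (b * a * b) * (a * b) := by rw [← hab]
      _ = Δ * (b * a * b) := by rw [hΔ]; group
      _ = Δ * Δ := by rw [← hab]
  have hyx : evalF2 f (b ^ 2) (a ^ 2) = s⁻¹ := by rw [hs]; exact evalF2_swap h2 _ _
  have hζx : Commute (Δ * Δ)⁻¹ (a ^ 2) := hωa.inv_left.pow_right 2
  have hζy : Commute (Δ * Δ)⁻¹ (b ^ 2) := hωb.inv_left.pow_right 2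
  have hζx' : Commute (Δ * Δ)⁻¹ (a * b ^ 2 * a⁻¹) :=
    (hωa.inv_left.mul_right hζy).mul_right hωa.inv_left.inv_right
  have ezx : evalF2 f (a ^ 2 * b ^ 2)⁻¹ (a ^ 2) = a * s⁻¹ * a⁻¹ := by
    have : evalF2 f (a * b ^ 2 * a⁻¹) (a * a ^ 2 * a⁻¹) = a * s⁻¹ * a⁻¹ := by
      rw [evalF2_conj, hyx]
    rw [hz, evalF2_mul_left_of_commute f hζx' hζx, h1, mul_one, ← this]
    congr 1; group
  have eyz : evalF2 f (b ^ 2) (a ^ 2 * b ^ 2)⁻¹ = b⁻¹ * s⁻¹ * b := by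
    have : evalF2 f (b⁻¹ * b ^ 2 * b⁻¹⁻¹) (b⁻¹ * a ^ 2 * b⁻¹⁻¹) = b⁻¹ * s⁻¹ * b⁻¹⁻¹ := by
      rw [evalF2_conj, hyx]
    rw [evalF2_swap h2, hz, evalF2_mul_left_of_commute f hζx' hζy, h1, mul_one, ← evalF2_swap h2,
      ← hx', ← inv_inv (b⁻¹ * s⁻¹ * b), show b⁻¹ * s⁻¹ * b = b⁻¹ * s⁻¹ * b⁻¹⁻¹ by group, ← this,
      inv_inv]
    group
  have ez : profPow (a ^ 2 * b ^ 2)⁻¹ m =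
      a * profPow (b ^ 2) m * a⁻¹ * (profPow (Δ * Δ) m)⁻¹ := by
    rw [hz, hζx'.symm.profPow_mul, profPow_conj, profPow_inv]
  have key := congrArg (profLift (FreeGroup.lift ![a ^ 2, b ^ 2])) h3
  have ex : profLift (FreeGroup.lift ![a ^ 2, b ^ 2]) xHat = a ^ 2 := evalF2_xHat _ _
  have ey : profLift (FreeGroup.lift ![a ^ 2, b ^ 2]) yHat = b ^ 2 := evalF2_yHat _ _
  simp only [map_mul, map_inv, map_evalF2, map_profPow, map_one, ex, ey] at key
  rw [ezx, eyz, ez, ← hs] at key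
  rw [profPow_two_mul_add_one, profPow_two_mul_add_one]
  have hWa : Commute (profPow (Δ * Δ) m) a := (hωa.symm.profPow_right m).symm
  have hWb : Commute (profPow (Δ * Δ) m) b := (hωb.symm.profPow_right m).symm
  refine braid_of_hexagon_word hab ?_ ?_ ?_ ?_ hWa hWb ?_ ((hWa.pow_right 2).profPow_right m)
    ((hWb.pow_right 2).profPow_right m) key
  · rw [← mul_inv_eq_iff_eq_mul, ← hyx, hs, ← evalF2_conj, ← conj_pow, ← conj_pow, ← hΔ, hΔa, hΔb]
  · rw [← mul_inv_eq_iff_eq_mul, ← profPow_conj, ← conj_pow, ← hΔ, hΔa]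
  · rw [← mul_inv_eq_iff_eq_mul, ← profPow_conj, ← conj_pow, ← hΔ, hΔb]
  · exact (((Commute.refl b).pow_right 2).profPow_right m).symm
  · rw [hs]
    exact (hWa.pow_right 2).evalF2_right (hWb.pow_right 2) f

end Hexagon

/-! ### The Hopfian property -/

section Hopfian

variable {G : Type} [Group G]

theorem finite_profCompl_hom [Group.FG G] {Q : Type*} [Group Q] [TopologicalSpace Q] [T2Space Q]
    [Finite Q] : Finite (ProfCompl G →ₜ* Q) := by
  obtain ⟨S, hS, hf⟩ := Group.fg_iff.1 ‹Group.FG G›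
  have := hf.to_subtype
  refine Finite.of_injective (fun χ (s : S) => χ (toProfCompl G s)) fun χ χ' h => ?_
  refine DFunLike.ext _ _ (profCompl_hom_ext fun g => ?_)
  refine DFunLike.congr_fun (f := (χ : ProfCompl G →* Q).comp (toProfCompl G))
    (g := (χ' : ProfCompl G →* Q).comp (toProfCompl G))
    (MonoidHom.eq_of_eqOn_dense hS fun s hs => congrFun h ⟨s, hs⟩) g

/-- The profinite completion of a finitely generated group is Hopfian. -/
theorem profCompl_hopfian [Group.FG G] (φ : ProfCompl G →ₜ* ProfCompl G)
    (hφ : Function.Surjective φ) : Function.Injective φ := by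
  refine (injective_iff_map_eq_one φ).2 fun x hx => profCompl_ext fun N => ?_
  let Q : ProfiniteGrp.{0} :=
    (ProfiniteGrp.ProfiniteCompletion.diagram (GrpCat.of G)).obj N
  have : Finite Q := inferInstanceAs (Finite (G ⧸ N.toSubgroup))
  have := finite_profCompl_hom (G := G) (Q := Q)
  let π : ProfCompl G →ₜ* Q :=
    { toMonoidHom := profProj N
      continuous_toFun := (continuous_apply N).comp continuous_subtype_val }
  -- Precomposition with a surjection is injective, hence bijective on the finite set of
  -- homomorphisms to `Q`. So the projection `π` factors through `φ` and kills its kernel.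
  have hinj : Function.Injective fun χ : ProfCompl G →ₜ* Q => χ.comp φ := fun χ χ' h =>
    DFunLike.ext _ _ fun y => by
      obtain ⟨z, rfl⟩ := hφ y
      exact DFunLike.congr_fun h z
  obtain ⟨χ, hχ⟩ := (Finite.injective_iff_surjective.1 hinj) π
  have : π x = χ (φ x) := (DFunLike.congr_fun hχ x).symm
  rw [hx, map_one] at this
  exact this.trans (map_one (profProj N)).symm

/-- A surjective continuous endomorphism of the profinite completion of a finitely generated
group, as an automorphism. -/
noncomputable def profComplAut [Group.FG G] (φ : ProfCompl G →ₜ* ProfCompl G)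
    (hφ : Function.Surjective φ) : ProfCompl G ≃ₜ* ProfCompl G :=
  { MulEquiv.ofBijective φ ⟨profCompl_hopfian φ hφ, hφ⟩ with
    continuous_toFun := φ.continuous_toFun
    continuous_invFun := (Continuous.homeoOfEquivCompactToT2
      (f := (MulEquiv.ofBijective φ ⟨profCompl_hopfian φ hφ, hφ⟩).toEquiv)
      φ.continuous_toFun).continuous_invFun }

theorem profPow_mem {H : Subgroup (ProfCompl G)} (hH : IsClosed (H : Set (ProfCompl G)))
    {x : ProfCompl G} (hx : x ∈ H) (a : ZHat) : profPow x a ∈ H :=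
  hH.mem_of_tendsto (tendsto_pow_profPow x a) (Eventually.of_forall fun _ => H.pow_mem hx _)

end Hopfian

/-! ### Drinfeld's action on the profinite braid group -/

section BraidAction

variable {N : ℕ} {f : F2Hat}

theorem commute_sigma_fBlock {p a b c j : ℕ} (h : p + a + b + c ≤ N) (h1 : j ≠ p)
    (h2 : j ≠ p + a) (h3 : j ≠ p + a + b) (h4 : j ≠ p + a + b + c) :
    Commute (toProfCompl _ (sigma N j)) (fBlock N f p a b c) :=
  ((commute_sigma_doubleCross (by omega) h1 h2 h3).map (toProfCompl _)).evalF2_right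
    ((commute_sigma_doubleCross (by omega) h2 h3 h4).map (toProfCompl _)) f

theorem commute_fBlock {x : ProfCompl (Braid N)} {p a b c : ℕ}
    (h : ∀ j, p < j → j < p + a + b + c → Commute x (toProfCompl _ (sigma N j))) :
    Commute x (fBlock N f p a b c) := by
  let H := (Subgroup.centralizer {x}).comap (toProfCompl (Braid N))
  have key : ∀ j, p < j → j < p + a + b + c → sigma N j ∈ H :=
    fun j h1 h2 => commute_iff_mem_centralizer.1 (h j h1 h2)
  have h1 : doubleCross N p a b ∈ H := doubleCross_mem fun j h1 h2 => key j h1 (by omega)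
  have h2 : doubleCross N (p + a) b c ∈ H := doubleCross_mem fun j h1 h2 => key j (by omega) h2
  exact (commute_iff_mem_centralizer.2 h1).evalF2_right (commute_iff_mem_centralizer.2 h2) f

theorem fBraid_eq_fBlock {p a b c : ℕ} (h : p + a + b + c ≤ N) :
    fBraid N f (List.range' (p + 1) a) (List.range' (p + a + 1) b)
      (List.range' (p + a + b + 1) c) = fBlock N f p a b c := by
  rw [fBraid, fPure, map_evalF2, profMap_toProfCompl, profMap_toProfCompl, Subgroup.coe_subtype,
    coe_blockX (by omega), coe_blockX (by omega), fBlock]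

/-- The prescribed image `f_{1⋯i-1,i,i+1}⁻¹ σ_i ^ lam f_{1⋯i-1,i,i+1}` of the generator `σ_i`. -/
noncomputable def gtSigma (N : ℕ) (lam : ZHat) (f : F2Hat) (i : ℕ) : ProfCompl (Braid N) :=
  (fBlock N f 0 (i - 1) 1 1)⁻¹ * profPow (toProfCompl _ (sigma N i)) lam *
    fBlock N f 0 (i - 1) 1 1

variable {lam : ZHat}

theorem commute_gtSigma {x : ProfCompl (Braid N)} {i : ℕ} (hi : 1 ≤ i)
    (h : ∀ j, 0 < j → j ≤ i → Commute x (toProfCompl _ (sigma N j))) :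
    Commute x (gtSigma N lam f i) := by
  have hf : Commute x (fBlock N f 0 (i - 1) 1 1) :=
    commute_fBlock fun j h1 h2 => h j h1 (by omega)
  exact (hf.inv_right.mul_right ((h i hi le_rfl).profPow_right lam)).mul_right hf

/-- The crossing σ_j lies inside the first block of f_{1⋯i-1,i,i+1} and is far from σ_i. -/
theorem commute_sigma_gtSigma {i j : ℕ} (h1 : 0 < j) (h2 : j + 1 < i) (h3 : i < N) :
    Commute (toProfCompl _ (sigma N j)) (gtSigma N lam f i) := by
  have hf : Commute (toProfCompl _ (sigma N j)) (fBlock N f 0 (i - 1) 1 1) :=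
    commute_sigma_fBlock (by omega) (by omega) (by omega) (by omega) (by omega)
  exact (hf.inv_right.mul_right
    (((commute_sigma h2).map (toProfCompl (Braid N))).profPow_right lam)).mul_right hf

theorem gtSigma_comm {i j : ℕ} (h1 : 1 ≤ i) (h2 : i + 1 < j) (h3 : j < N) :
    gtSigma N lam f i * gtSigma N lam f j = gtSigma N lam f j * gtSigma N lam f i :=
  ((commute_gtSigma h1 fun _ h4 h5 =>
    (commute_sigma_gtSigma h4 (by omega) h3).symm).symm).eq

/-- Conjugation by an element that commutes with `x` does not change the conjugates of `x`. -/
theorem conj_eq_of_commute {G : Type*} [Group G] {x g : G} (h : Commute x g) (k : G) :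
    (g * k)⁻¹ * x * (g * k) = k⁻¹ * x * k := by
  calc _ = k⁻¹ * g⁻¹ * (x * g) * k := by group
    _ = _ := by rw [h.eq]; group

/-- By the pentagon for cables of widths k, 1, 1, 1, one common conjugation by `g` turns the two
elements into σ_i^λ and s⁻¹ σ_{i+1}^λ s, where s = f(σ_i², σ_{i+1}²). That is the situation of
`braid_of_hexagon`. -/
theorem gtSigma_braid {lam : ZHatˣ} {σ : F2Hat ≃ₜ* F2Hat} (hσ : IsGTElement σ lam f) {i : ℕ}
    (h1 : 1 ≤ i) (h2 : i + 1 < N) :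
    gtSigma N lam f i * gtSigma N lam f (i + 1) * gtSigma N lam f i =
      gtSigma N lam f (i + 1) * gtSigma N lam f i * gtSigma N lam f (i + 1) := by
  obtain ⟨k, rfl⟩ : ∃ k, i = k + 1 := ⟨i - 1, by omega⟩
  obtain ⟨m, hm, hhex⟩ := hσ.hexagon
  have hpent := fBlock_pentagon (N := N) hσ.pentagon (a := k) (b := 1) (c := 1) (d := 1) (by omega)
  have hc1 : Commute (profPow (toProfCompl _ (sigma N (k + 1))) (lam : ZHat))
      (fBlock N f 0 k (1 + 1) 1) :=
    ((commute_sigma_fBlock (by omega) (by omega) (by omega) (by omega) (by omega)).symm.profPow_right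
      _).symm
  have hc2 : Commute (profPow (toProfCompl _ (sigma N (k + 1 + 1))) (lam : ZHat))
      (fBlock N f 0 k 1 (1 + 1)) :=
    ((commute_sigma_fBlock (by omega) (by omega) (by omega) (by omega) (by omega)).symm.profPow_right
      _).symm
  set g := fBlock N f 0 k (1 + 1) 1 * fBlock N f 0 k 1 1 with hg
  set s := fBlock N f k 1 1 1 with hs
  have e1 : gtSigma N lam f (k + 1) =
      g⁻¹ * profPow (toProfCompl _ (sigma N (k + 1))) (lam : ZHat) * g := by
    rw [hg, conj_eq_of_commute hc1]; rfl
  have e2 : gtSigma N lam f (k + 1 + 1) =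
      g⁻¹ * (s⁻¹ * profPow (toProfCompl _ (sigma N (k + 1 + 1))) (lam : ZHat) * s) * g := by
    have : gtSigma N lam f (k + 1 + 1) = (fBlock N f 0 (k + 1) 1 1)⁻¹ *
      profPow (toProfCompl _ (sigma N (k + 1 + 1))) (lam : ZHat) * fBlock N f 0 (k + 1) 1 1 := rfl
    rw [this, ← conj_eq_of_commute hc2, hpent, mul_assoc s, ← hg]
    group
  have hb := congrArg (toProfCompl (Braid N)) (sigma_braid h1 h2)
  simp only [map_mul] at hb
  have hs' : s = evalF2 f (toProfCompl _ (sigma N (k + 1)) ^ 2)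
      (toProfCompl _ (sigma N (k + 1 + 1)) ^ 2) := by
    rw [hs, fBlock, doubleCross_one_one, doubleCross_one_one, map_pow, map_pow]
  have key := braid_of_hexagon hσ.two_cycle hhex (fun α => evalF2_one_right hσ.pentagon α) hb hs'
  rw [← hm] at key
  rw [e1, e2]
  generalize profPow (toProfCompl _ (sigma N (k + 1))) (lam : ZHat) = A at key ⊢
  generalize s⁻¹ * profPow (toProfCompl _ (sigma N (k + 1 + 1))) (lam : ZHat) * s = B at key ⊢
  calc _ = g⁻¹ * (A * B * A) * g := by group
    _ = g⁻¹ * (B * A * B) * g := by rw [key]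
    _ = _ := by group

theorem evalF2_one_left {lam : ZHatˣ} {σ : F2Hat ≃ₜ* F2Hat} (hσ : IsGTElement σ lam f)
    {P : ProfiniteGrp.{0}} (β : P) : evalF2 f 1 β = 1 := by
  rw [evalF2_swap hσ.two_cycle β 1, evalF2_one_right hσ.pentagon, inv_one]

theorem fBlock_zero {lam : ZHatˣ} {σ : F2Hat ≃ₜ* F2Hat} (hσ : IsGTElement σ lam f)
    (p b c : ℕ) : fBlock N f p 0 b c = 1 := by
  rw [fBlock, doubleCross_zero_left, map_one, evalF2_one_left hσ]

/-- The separate clause for σ_1 is the uniform formula with an empty first block, because f(1,β) =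
1. -/
theorem actsOnGenerators_iff {lam : ZHatˣ} {σ : F2Hat ≃ₜ* F2Hat} (hσ : IsGTElement σ lam f)
    (φ : ProfCompl (Braid N) → ProfCompl (Braid N)) : ActsOnGenerators lam f N φ ↔
      ∀ i, 1 ≤ i → i < N → φ (toProfCompl _ (sigma N i)) = gtSigma N lam f i := by
  have h0 : gtSigma N lam f 1 = profPow (toProfCompl _ (sigma N 1)) (lam : ZHat) := by
    rw [gtSigma, Nat.sub_self, fBlock_zero hσ]; group
  have hi : ∀ i, 2 ≤ i → i < N → (fBraid N f (List.range' 1 (i - 1)) [i] [i + 1])⁻¹ *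
      profPow (toProfCompl _ (sigma N i)) lam *
      fBraid N f (List.range' 1 (i - 1)) [i] [i + 1] = gtSigma N lam f i := by
    intro i h1 h2
    have := fBraid_eq_fBlock (N := N) (f := f) (p := 0) (a := i - 1) (b := 1) (c := 1) (by omega)
    rw [show 0 + (i - 1) + 1 = i by omega, zero_add] at this
    rw [gtSigma, ← this]; rfl
  constructor
  · rintro ⟨ha, hb⟩ i h1 h2
    obtain rfl | h1 := h1.eq_or_lt
    · rw [ha (by omega), h0]
    · rw [hb i h1 h2, hi i h1 h2]
  · exact fun h => ⟨fun h2 => by rw [h 1 le_rfl (by omega), h0],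
      fun i h1 h2 => by rw [h i (by omega) h2, hi i h1 h2]⟩

theorem closure_sigma : Subgroup.closure {g | ∃ i, 1 ≤ i ∧ i < N ∧ g = sigma N i} = ⊤ := by
  rw [eq_top_iff, ← PresentedGroup.closure_range_of, Subgroup.closure_le]
  rintro _ ⟨i, rfl⟩
  refine Subgroup.subset_closure ⟨i + 1, by omega, by omega, ?_⟩
  rw [sigma, dif_pos ⟨by omega, by omega⟩]; rfl

theorem braid_hom_ext {Q : Type*} [Group Q] [TopologicalSpace Q] [T2Space Q]
    {φ ψ : ProfCompl (Braid N) →ₜ* Q}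
    (h : ∀ i, 1 ≤ i → i < N →
      φ (toProfCompl _ (sigma N i)) = ψ (toProfCompl _ (sigma N i))) (x : ProfCompl (Braid N)) :
    φ x = ψ x := by
  refine profCompl_hom_ext (fun g => ?_) x
  refine DFunLike.congr_fun (f := (φ : ProfCompl (Braid N) →* Q).comp (toProfCompl _))
    (g := (ψ : ProfCompl (Braid N) →* Q).comp (toProfCompl _))
    (MonoidHom.eq_of_eqOn_dense closure_sigma ?_) g
  rintro _ ⟨i, h1, h2, rfl⟩
  exact h i h1 h2

/-- A closed subgroup that contains the generators is everything. -/
theorem eq_top_of_sigma_mem {H : Subgroup (ProfCompl (Braid N))}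
    (hH : IsClosed (H : Set (ProfCompl (Braid N))))
    (h : ∀ i, 1 ≤ i → i < N → toProfCompl _ (sigma N i) ∈ H) : H = ⊤ := by
  have h1 : (⊤ : Subgroup (Braid N)) ≤ H.comap (toProfCompl _) := by
    rw [← closure_sigma, Subgroup.closure_le]
    rintro _ ⟨i, h1, h2, rfl⟩
    exact h i h1 h2
  have hd : Dense (Set.range (toProfCompl (Braid N))) := denseRange_toProfCompl
  refine eq_top_iff.2 fun x _ => hH.closure_subset_iff.2 ?_ (hd x)
  rintro _ ⟨g, rfl⟩
  exact h1 (Subgroup.mem_top g)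

instance : Group.FG (Braid N) := Group.fg_iff.2
  ⟨_, PresentedGroup.closure_range_of _, Set.finite_range _⟩

/-- A closed subgroup that contains `α` and `f(α, β)⁻¹ β ^ lam f(α, β)` contains all values
`w(α, β)`. -/
theorem mem_of_gt_mem {lam : ZHatˣ} {σ : F2Hat ≃ₜ* F2Hat} (hσ : IsGTElement σ lam f)
    {G : Type} [Group G] {H : Subgroup (ProfCompl G)} (hH : IsClosed (H : Set (ProfCompl G)))
    {α β : ProfCompl G} (hα : α ∈ H)
    (hβ : (evalF2 f α β)⁻¹ * profPow β lam * evalF2 f α β ∈ H) (w : F2Hat) :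
    evalF2 w α β ∈ H := by
  -- Surjectivity of σ on the free group enters here: w = σ(v) gives w(α,β) = v(α^λ, f⁻¹β^λ f), with
  -- both arguments in `H`.
  obtain ⟨v, rfl⟩ := σ.surjective w
  let E : F2Hat →ₜ* ProfCompl G := profLift (FreeGroup.lift ![α, β])
  have ex : E xHat = α := evalF2_xHat α β
  have ey : E yHat = β := evalF2_yHat α β
  have hv := hom_eq_evalF2 (E.comp (σ : F2Hat →ₜ* F2Hat)) v
  change E (σ v) = evalF2 v (E (σ xHat)) (E (σ yHat)) at hv
  rw [hσ.map_x, hσ.map_y, map_mul, map_mul, map_inv, map_profPow, map_profPow, ex, ey] at hv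
  change E (σ v) ∈ H
  rw [hv]
  exact evalF2_mem hH (profPow_mem hH hα _) hβ v

/-- Induction on `i`: the earlier generators give x_{1⋯i-1,i}, so `mem_of_gt_mem` puts the
conjugator f_{1⋯i-1,i,i+1} in `H`. Removing it leaves σ_i^λ, and λ is invertible. -/
theorem sigma_mem_of_gtSigma_mem {lam : ZHatˣ} {σ : F2Hat ≃ₜ* F2Hat}
    (hσ : IsGTElement σ lam f) {H : Subgroup (ProfCompl (Braid N))}
    (hH : IsClosed (H : Set (ProfCompl (Braid N))))
    (h : ∀ i, 1 ≤ i → i < N → gtSigma N lam f i ∈ H) (i : ℕ) (h1 : 1 ≤ i) (h2 : i < N) :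
    toProfCompl _ (sigma N i) ∈ H := by
  induction i using Nat.strong_induction_on with
  | _ i ih =>
    obtain ⟨k, rfl⟩ : ∃ k, i = k + 1 := ⟨i - 1, by omega⟩
    have hy : toProfCompl _ (doubleCross N 0 k 1) ∈ H :=
      doubleCross_mem (H := H.comap (toProfCompl _)) fun j h3 h4 =>
        ih j (by omega) (by omega) (by omega)
    have hg := h _ h1 h2
    set s := fBlock N f 0 k 1 1 with hs
    have hg' : gtSigma N lam f (k + 1) =
      s⁻¹ * profPow (toProfCompl _ (sigma N (k + 1))) lam * s := rfl
    -- The second argument of f is σ_i², not σ_i, so the prescribed image has to be squared.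
    have hpow : profPow (toProfCompl _ (doubleCross N (0 + k) 1 1)) (lam : ZHat) =
        profPow (toProfCompl _ (sigma N (k + 1))) (lam : ZHat) ^ 2 := by
      rw [doubleCross_one_one, zero_add, map_pow, sq, (Commute.refl _).profPow_mul, sq]
    have hβ : s⁻¹ * profPow (toProfCompl _ (doubleCross N (0 + k) 1 1)) lam * s ∈ H := by
      have := H.pow_mem hg 2
      rw [hg', sq] at this
      rw [hpow, sq]
      convert this using 1
      group
    have hsH : s ∈ H := mem_of_gt_mem hσ hH hy hβ f
    have hlam : profPow (toProfCompl _ (sigma N (k + 1))) (lam : ZHat) ∈ H := by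
      have := H.mul_mem (H.mul_mem hsH hg) (H.inv_mem hsH)
      rw [hg'] at this
      convert this using 1
      group
    have := profPow_mem hH hlam ((lam⁻¹ : ZHatˣ) : ZHat)
    rwa [← profPow_mul, Units.mul_inv, profPow_one] at this

/-- Drinfeld's action, as an endomorphism. -/
noncomputable def gtEnd {lam : ZHatˣ} {σ : F2Hat ≃ₜ* F2Hat} (hσ : IsGTElement σ lam f) (N : ℕ) :
    ProfCompl (Braid N) →ₜ* ProfCompl (Braid N) :=
  profLift (braidLift N (gtSigma N lam f) (fun _ h1 h2 => gtSigma_braid hσ h1 h2)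
    (fun _ _ h1 h2 h3 => gtSigma_comm h1 h2 h3))

theorem braidLift_sigma {G : Type} [Group G] {s : ℕ → G}
    (h1 : ∀ i, 1 ≤ i → i + 1 < N → s i * s (i + 1) * s i = s (i + 1) * s i * s (i + 1))
    (h2 : ∀ i j, 1 ≤ i → i + 1 < j → j < N → s i * s j = s j * s i) {i : ℕ} (hi : 1 ≤ i)
    (hi' : i < N) : braidLift N s h1 h2 (sigma N i) = s i := by
  rw [sigma, dif_pos ⟨hi, hi'⟩, braidLift, PresentedGroup.toGroup.of]
  simp only [Nat.sub_add_cancel hi]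

theorem gtEnd_sigma {lam : ZHatˣ} {σ : F2Hat ≃ₜ* F2Hat} (hσ : IsGTElement σ lam f) {i : ℕ}
    (h1 : 1 ≤ i) (h2 : i < N) :
    gtEnd hσ N (toProfCompl _ (sigma N i)) = gtSigma N lam f i := by
  rw [gtEnd, profLift_toProfCompl, braidLift_sigma _ _ h1 h2]

theorem gtEnd_surjective {lam : ZHatˣ} {σ : F2Hat ≃ₜ* F2Hat} (hσ : IsGTElement σ lam f) (N : ℕ) :
    Function.Surjective (gtEnd hσ N) := by
  let H : Subgroup (ProfCompl (Braid N)) := (gtEnd hσ N : ProfCompl (Braid N) →* _).range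
  have hH : IsClosed (H : Set (ProfCompl (Braid N))) :=
    (isCompact_range (gtEnd hσ N).continuous_toFun).isClosed
  have := eq_top_of_sigma_mem hH (sigma_mem_of_gtSigma_mem hσ hH fun i h1 h2 =>
    ⟨_, gtEnd_sigma hσ h1 h2⟩)
  exact MonoidHom.range_eq_top.1 this

/-- Drinfeld's action on the profinite braid group. -/
noncomputable def gtAut {lam : ZHatˣ} {σ : F2Hat ≃ₜ* F2Hat} (hσ : IsGTElement σ lam f) (N : ℕ) :
    ProfCompl (Braid N) ≃ₜ* ProfCompl (Braid N) :=
  profComplAut (gtEnd hσ N) (gtEnd_surjective hσ N)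

end BraidAction

/-! ### Adding trivial strands on both sides -/

section Padding

variable {f : F2Hat}

theorem pad_sigma {m₁ n m₂ i : ℕ} (h1 : 1 ≤ i) (h2 : i < n) :
    pad m₁ n m₂ (sigma n i) = sigma (m₁ + n + m₂) (m₁ + i) :=
  braidLift_sigma _ _ h1 h2

theorem pad_strandCross {m₁ n m₂ p a : ℕ} (h : p + a < n) :
    pad m₁ n m₂ (strandCross n p a) = strandCross (m₁ + n + m₂) (m₁ + p) a := by
  induction a with
  | zero => simp [strandCross]
  | succ a ih =>
    rw [strandCross, map_mul, ih (by omega), pad_sigma (by omega) (by omega), strandCross]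
    simp only [add_assoc]

theorem pad_blockCross {m₁ n m₂ p a b : ℕ} (h : p + a + b ≤ n) :
    pad m₁ n m₂ (blockCross n p a b) = blockCross (m₁ + n + m₂) (m₁ + p) a b := by
  induction b with
  | zero => simp [blockCross]
  | succ b ih =>
    rw [blockCross, map_mul, ih (by omega), pad_strandCross (by omega), blockCross,
      add_assoc m₁ p]

theorem pad_doubleCross {m₁ n m₂ p a b : ℕ} (h : p + a + b ≤ n) :
    pad m₁ n m₂ (doubleCross n p a b) = doubleCross (m₁ + n + m₂) (m₁ + p) a b := by
  rw [doubleCross, map_mul, pad_blockCross h, pad_blockCross (by omega), doubleCross]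

theorem profMap_pad_fBlock {m₁ n m₂ p a b c : ℕ} (h : p + a + b + c ≤ n) :
    profMap (pad m₁ n m₂) (fBlock n f p a b c) = fBlock (m₁ + n + m₂) f (m₁ + p) a b c := by
  rw [fBlock, map_evalF2, profMap_toProfCompl, profMap_toProfCompl, pad_doubleCross (by omega),
    pad_doubleCross (by omega), fBlock, add_assoc m₁ p]

theorem profMap_pad_gtSigma {lam : ZHat} {m₁ n m₂ i : ℕ} (h1 : 1 ≤ i) (h2 : i < n) :
    profMap (pad m₁ n m₂) (gtSigma n lam f i) =
      (fBlock (m₁ + n + m₂) f m₁ (i - 1) 1 1)⁻¹ *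
        profPow (toProfCompl _ (sigma (m₁ + n + m₂) (m₁ + i))) lam *
        fBlock (m₁ + n + m₂) f m₁ (i - 1) 1 1 := by
  rw [gtSigma, map_mul, map_mul, map_inv, map_profPow, profMap_pad_fBlock (by omega),
    profMap_toProfCompl, pad_sigma h1 h2, add_zero]

/-- The product `f_{1⋯m, m+1⋯m+q, m+q+1} ⋯ f_{1⋯m, m+1, m+2}`. -/
noncomputable def fBlockProd (N : ℕ) (f : F2Hat) (m : ℕ) : ℕ → ProfCompl (Braid N)
  | 0 => 1
  | q + 1 => fBlock N f 0 m (q + 1) 1 * fBlockProd N f m q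

theorem fBracket_eq {m₁ m₂ q : ℕ} :
    fBracket f m₁ (q + 1) m₂ = fBlockProd (m₁ + (q + 1) + m₂) f m₁ q := by
  have : ∀ r, r ≤ q → ((List.range' 1 r).reverse.map fun k =>
      fBraid (m₁ + (q + 1) + m₂) f (List.range' 1 m₁) (List.range' (m₁ + 1) k)
        [m₁ + k + 1]).prod = fBlockProd (m₁ + (q + 1) + m₂) f m₁ r := by
    intro r hr
    induction r with
    | zero => rfl
    | succ r ih =>
      have := fBraid_eq_fBlock (N := m₁ + (q + 1) + m₂) (f := f) (p := 0) (a := m₁) (b := r + 1)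
        (c := 1) (by omega)
      simp only [zero_add] at this
      rw [List.range'_concat, List.reverse_append, List.map_append, List.prod_append,
        ih (by omega), fBlockProd, ← this]
      simp [add_comm 1 r]
  exact this q le_rfl

theorem commute_fBlockProd {N m q : ℕ} {x : ProfCompl (Braid N)}
    (h : ∀ j, 0 < j → j ≤ m + q → Commute x (toProfCompl _ (sigma N j))) :
    Commute x (fBlockProd N f m q) := by
  induction q with
  | zero => exact Commute.one_right _
  | succ q ih =>
    exact (commute_fBlock fun j h1 h2 => h j h1 (by omega)).mul_right
      (ih fun j h1 h2 => h j h1 (by omega))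

/-- The pentagon produces the bracket factors with middle blocks of size i and i - 1. Factors with
smaller middle blocks commute with the whole element. Those with larger ones commute with everything
inside the middle block. -/
theorem gtSigma_eq_conj {lam : ZHatˣ} {σ : F2Hat ≃ₜ* F2Hat} (hσ : IsGTElement σ lam f)
    {N m i q : ℕ} (hi : 1 ≤ i) (hq : i ≤ q) (hN : m + q < N) :
    gtSigma N lam f (m + i) = (fBlockProd N f m q)⁻¹ *
      ((fBlock N f m (i - 1) 1 1)⁻¹ * profPow (toProfCompl _ (sigma N (m + i))) lam *
        fBlock N f m (i - 1) 1 1) * fBlockProd N f m q := by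
  obtain ⟨k, rfl⟩ : ∃ k, i = k + 1 := ⟨i - 1, by omega⟩
  have hgt : gtSigma N lam f (m + (k + 1)) = (fBlock N f 0 (m + k) 1 1)⁻¹ *
    profPow (toProfCompl _ (sigma N (m + (k + 1)))) lam * fBlock N f 0 (m + k) 1 1 := rfl
  rw [Nat.add_sub_cancel]
  induction q, hq using Nat.le_induction with
  | base =>
    have hpent := fBlock_pentagon (N := N) hσ.pentagon (a := m) (b := k) (c := 1) (d := 1)
      (by omega)
    have hc : Commute (profPow (toProfCompl _ (sigma N (m + (k + 1)))) (lam : ZHat))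
        (fBlock N f 0 m k (1 + 1)) :=
      ((commute_sigma_fBlock (by omega) (by omega) (by omega) (by omega)
        (by omega)).symm.profPow_right _).symm
    -- For `k = 0` the bracket has no factor with an empty middle block, but that factor is f(1,1) =
    -- 1, so the same shape holds.
    have hP : ∃ r, fBlockProd N f m k = fBlock N f 0 m k 1 * r ∧
        Commute (gtSigma N lam f (m + (k + 1))) r := by
      cases k with
      | zero =>
        refine ⟨1, ?_, Commute.one_right _⟩
        rw [fBlock, doubleCross_zero_right, map_one, doubleCross_zero_left, map_one,
          evalF2_one_left hσ, mul_one]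
        rfl
      | succ k =>
        exact ⟨_, rfl, commute_fBlockProd fun j h1 h2 =>
          (commute_sigma_gtSigma h1 (by omega) (by omega)).symm⟩
    obtain ⟨r, hr, hcr⟩ := hP
    rw [fBlockProd, hr]
    have e : gtSigma N lam f (m + (k + 1)) = (fBlock N f m k 1 1 * fBlock N f 0 m (k + 1) 1 *
        fBlock N f 0 m k 1)⁻¹ * profPow (toProfCompl _ (sigma N (m + (k + 1)))) lam *
        (fBlock N f m k 1 1 * fBlock N f 0 m (k + 1) 1 * fBlock N f 0 m k 1) := by
      rw [hgt, ← conj_eq_of_commute hc, hpent]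
    have e' : gtSigma N lam f (m + (k + 1)) =
        r⁻¹ * gtSigma N lam f (m + (k + 1)) * r := by
      rw [mul_assoc, hcr.eq, inv_mul_cancel_left]
    rw [e', e]
    group
  | succ q hq ih =>
    have hsig : Commute (toProfCompl _ (sigma N (m + (k + 1)))) (fBlock N f 0 m (q + 1) 1) :=
      commute_sigma_fBlock (by omega) (by omega) (by omega) (by omega) (by omega)
    have hc1 : Commute (profPow (toProfCompl _ (sigma N (m + (k + 1)))) (lam : ZHat))
        (fBlock N f 0 m (q + 1) 1) := (hsig.symm.profPow_right _).symm
    have hc2 : Commute (fBlock N f m k 1 1) (fBlock N f 0 m (q + 1) 1) :=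
      (commute_fBlock fun j h1 h2 => (commute_sigma_fBlock (by omega) (by omega) (by omega)
        (by omega) (by omega)).symm).symm
    -- The new leading factor has σ_{m+i} and its conjugator inside its middle block, so it drops
    -- out.
    rw [fBlockProd, conj_eq_of_commute ((hc2.inv_left.mul_left hc1).mul_left hc2)]
    exact ih (by omega)

end Padding

/-! ### The action and the padding formula -/

theorem mainTheorem10 (σ : F2Hat ≃ₜ* F2Hat) (lam : ZHatˣ) (f : F2Hat)
    (hσ : IsGTElement σ lam f) :
    ∃ ρ : ∀ n : ℕ, ProfCompl (Braid n) ≃ₜ* ProfCompl (Braid n),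
      (∀ n, ActsOnGenerators lam f n (ρ n)) ∧
      (∀ n (φ : ProfCompl (Braid n) →ₜ* ProfCompl (Braid n)),
        ActsOnGenerators lam f n φ → ∀ b, φ b = ρ n b) ∧
      ∀ (n m₁ m₂ : ℕ), 0 < n → ∀ b : ProfCompl (Braid n),
        ρ (m₁ + n + m₂) (profMap (pad m₁ n m₂) b) =
          (fBracket f m₁ n m₂)⁻¹ * profMap (pad m₁ n m₂) (ρ n b) * fBracket f m₁ n m₂ := by
  refine ⟨gtAut hσ, fun n => ?_, fun n φ hφ b => ?_, fun n m₁ m₂ hn b => ?_⟩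
  · exact (actsOnGenerators_iff hσ _).2 fun i h1 h2 => gtEnd_sigma hσ h1 h2
  · change φ b = gtEnd hσ n b
    refine braid_hom_ext (fun i h1 h2 => ?_) b
    rw [(actsOnGenerators_iff hσ _).1 hφ i h1 h2, gtEnd_sigma hσ h1 h2]
  · obtain ⟨q, rfl⟩ : ∃ q, n = q + 1 := ⟨n - 1, by omega⟩
    rw [fBracket_eq]
    set F := fBlockProd (m₁ + (q + 1) + m₂) f m₁ q
    have := braid_hom_ext (φ := (gtEnd hσ (m₁ + (q + 1) + m₂)).comp (profMap (pad m₁ (q + 1) m₂)))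
      (ψ := (conjHom F⁻¹).comp ((profMap (pad m₁ (q + 1) m₂)).comp (gtEnd hσ (q + 1))))
      (fun i h1 h2 => by
        change gtEnd hσ _ (profMap _ _) = F⁻¹ * profMap _ (gtEnd hσ _ _) * F⁻¹⁻¹
        rw [profMap_toProfCompl, pad_sigma h1 h2, gtEnd_sigma hσ (by omega) (by omega),
          gtEnd_sigma hσ h1 h2, profMap_pad_gtSigma h1 h2, inv_inv]
        exact gtSigma_eq_conj hσ h1 (by omega) (by omega)) b
    change gtEnd hσ _ (profMap _ _) = F⁻¹ * profMap _ (gtEnd hσ _ _) * F⁻¹⁻¹ at this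
    rw [inv_inv] at this
    exact this
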